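/- Let $V$ be a finite-dimensional complex vector space and $R\subset V$ a subset spanning $V$. "Algebraic subgroup" means Zariski closed subgroup, over $\mathbb C$ in (1) and (2), and over $\mathbb R$ in (3), where $U(V,h)$ is regarded as a real algebraic group. A subspace $U$ of $V$ is called nontrivial if $U\ne 0$ and $U\neq V$, and $U^\perp$ is its orthogonal complement for the given form. (1) Let $Q$ be a non-degenerate alternating bilinear form on $V$, and let $M$ be the smallest algebraic subgroup of the symplectic group $Sp(V,Q)$ containing the transvections $x\mapsto x+Q(x,\delta)\delta$ for all $\delta\in R$. Suppose that $R$ is a finite union of $M$-orbits. Then at least one of the following holds: (a) there is a nontrivial $M$-invariant subspace $U$ of $V$ such that $R\subset U\cup U^{\perp}$; (b) $M=Sp(V,Q)$. (2) Let $Q$ be a non-degenerate symmetric bilinear form on $V$, assume $Q(\delta,\delta)=2$ for all $\delta\in R$, and let $M$ be the smallest algebraic subgroup of the orthogonal group $O(V,Q)$ containing the reflections $x\mapsto x-Q(x,\delta)\delta$ for all $\delta\in R$. Suppose that $R$ is a finite union of $M$-orbits. Then at least one of the following holds: (a) there is a nontrivial $M$-invariant subspace $U$ of $V$ such that $R\subset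 U\cup U^{\perp}$; (b) $M$ is finite; (c) $M=O(V,Q)$. (3) Let $\epsilon\in\{1,-1\}$, let $\lambda\neq\pm1$ be a root of unity, and let $h$ be a non-degenerate Hermitian form on $V$ (linear in the first variable) of signature $(p,q)$ with $p+q=\dim_{\mathbb C} V>1$. Assume $h(\delta,\delta)=\epsilon$ for all $\delta\in R$, and let $M$ be the smallest (real) algebraic subgroup of the unitary group $U(V,h)$ containing the complex reflections $x\mapsto x+\epsilon(\lambda-1)h(x,\delta)\delta$ for all $\delta\in R$. Suppose that $R$ is a finite union of $M$-orbits. Then at least one of the following holds: (a) there is a nontrivial $M$-invariant subspace $U$ of $V$ such that $R\subset U\cup U^{\perp}$; (b) $M$ is finite; (c) $PM=PU(V,h)$, where $PU(V,h)$ is the quotient of $U(V,h)$ by its center and $PM$ is the image of $M$ in it. -/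

import Mathlib

/-- The ring of polynomial functions on a `k`-vector space `W`: the `k`-algebra of functions
generated by the `k`-linear functionals. -/
def polyFunctionAlgebra (k W : Type*) [Field k] [AddCommGroup W] [Module k W] :
    Subalgebra k (W → k) :=
  Algebra.adjoin k (Set.range fun (φ : Module.Dual k W) (w : W) => φ w)

/-- `S` is Zariski closed over `k`: it is the set of common zeros of a family of polynomial
functions with coefficients in `k`. -/
def IsZariskiClosed (k : Type*) {W : Type*} [Field k] [AddCommGroup W] [Module k W]
    (S : Set W) : Prop :=
  ∃ P : Set (W → k), P ⊆ (polyFunctionAlgebra k W : Set (W → k)) ∧ S = {w | ∀ p ∈ P, p w = 0}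

section

variable {V : Type*} [AddCommGroup V] [Module ℂ V]

/-- A subgroup of `GL(V)` is algebraic over `k` if it is the trace on `GL(V)` of a Zariski closed
subset of `End(V)`. For `k = ℂ` these are the complex algebraic subgroups of `GL(V)`; for `k = ℝ`
the polynomial equations are in the real coordinates of `End(V)`, and these are the real algebraic
subgroups of `GL(V)` seen as a real algebraic group. -/
def IsAlgebraicSubgroup (k : Type*) [Field k] [Module k (Module.End ℂ V)]
    (N : Subgroup (V ≃ₗ[ℂ] V)) : Prop :=
  ∃ Z : Set (Module.End ℂ V), IsZariskiClosed k Z ∧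
    ∀ g : V ≃ₗ[ℂ] V, g ∈ N ↔ (g : V →ₗ[ℂ] V) ∈ Z

/-- The group of linear automorphisms of `V` preserving the form `B`: it is `Sp(V, B)`,
`O(V, B)`, `U(V, B)` for `B` nondegenerate alternating, symmetric, Hermitian. -/
def isometryGroup {σ : ℂ →+* ℂ} (B : V →ₗ[ℂ] V →ₛₗ[σ] ℂ) : Subgroup (V ≃ₗ[ℂ] V) where
  carrier := {g | ∀ x y, B (g x) (g y) = B x y}
  one_mem' := fun _ _ => rfl
  mul_mem' := fun {a b} ha hb x y => (ha (b x) (b y)).trans (hb x y)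
  inv_mem' := fun {a} ha x y => by
    have h := ha (a⁻¹ x) (a⁻¹ y)
    have e : ∀ z, a (a⁻¹ z) = z := fun z => a.apply_symm_apply z
    rw [e, e] at h
    exact h.symm

/-- The map `x ↦ x + c B(x, δ) δ`. -/
def rankOnePerturbation {σ : ℂ →+* ℂ} (B : V →ₗ[ℂ] V →ₛₗ[σ] ℂ) (c : ℂ) (δ : V) :
    Module.End ℂ V where
  toFun x := x + (c * B x δ) • δ
  map_add' x y := by
    simp only [map_add, LinearMap.add_apply, mul_add, add_smul]
    abel
  map_smul' a x := by
    simp only [map_smul, LinearMap.smul_apply, smul_eq_mul, RingHom.id_apply, smul_add, smul_smul]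
    congr 2
    ring

/-- The algebraic (over `k`) subgroups of `G` that contain all the maps in `T`. -/
def algebraicSubgroupsContaining (k : Type*) [Field k] [Module k (Module.End ℂ V)]
    (G : Subgroup (V ≃ₗ[ℂ] V)) (T : Set (Module.End ℂ V)) : Set (Subgroup (V ≃ₗ[ℂ] V)) :=
  {N | N ≤ G ∧ IsAlgebraicSubgroup k N ∧ ∀ t ∈ T, ∃ g ∈ N, (g : V →ₗ[ℂ] V) = t}

/-- The smallest algebraic (over `k`) subgroup of `G` that contains all the maps in `T`. -/
def algebraicHull (k : Type*) [Field k] [Module k (Module.End ℂ V)]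
    (G : Subgroup (V ≃ₗ[ℂ] V)) (T : Set (Module.End ℂ V)) : Subgroup (V ≃ₗ[ℂ] V) :=
  sInf (algebraicSubgroupsContaining k G T)

/-- The intersection defining `algebraicHull` is a minimum as soon as `G` is algebraic and contains
the maps in `T`. -/
theorem isLeast_algebraicHull (k : Type*) [Field k] [Module k (Module.End ℂ V)]
    (G : Subgroup (V ≃ₗ[ℂ] V)) (T : Set (Module.End ℂ V)) (hG : IsAlgebraicSubgroup k G)
    (hT : ∀ t ∈ T, ∃ g ∈ G, (g : V →ₗ[ℂ] V) = t) :
    IsLeast (algebraicSubgroupsContaining k G T) (algebraicHull k G T) := by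
  refine ⟨⟨sInf_le ⟨le_rfl, hG, hT⟩, ?_, ?_⟩, fun N hN => sInf_le hN⟩
  · have hc : ∀ N : algebraicSubgroupsContaining k G T, ∃ P : Set (Module.End ℂ V → k),
        P ⊆ (polyFunctionAlgebra k (Module.End ℂ V) : Set (Module.End ℂ V → k)) ∧
        ∀ g : V ≃ₗ[ℂ] V, g ∈ N.1 ↔ ∀ p ∈ P, p (g : V →ₗ[ℂ] V) = 0 := by
      rintro ⟨N, -, ⟨Z, ⟨P, hP, rfl⟩, hZ⟩, -⟩
      exact ⟨P, hP, hZ⟩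
    choose P hP hPN using hc
    refine ⟨{w | ∀ p ∈ ⋃ N, P N, p w = 0},
      ⟨_, Set.iUnion_subset hP, rfl⟩, fun g => ?_⟩
    simp only [algebraicHull, Subgroup.mem_sInf, Set.mem_ofPred_eq, Set.mem_iUnion]
    constructor
    · rintro h p ⟨N, hp⟩
      exact (hPN N g).1 (h N.1 N.2) p hp
    · intro h N hN
      exact (hPN ⟨N, hN⟩ g).2 fun p hp => h p ⟨_, hp⟩
  · intro t ht
    obtain ⟨g, -, hg⟩ := hT t ht
    refine ⟨g, Subgroup.mem_sInf.2 fun N hN => ?_, hg⟩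
    obtain ⟨g', hg', e⟩ := hN.2.2 t ht
    rwa [← LinearEquiv.toLinearMap_injective (e.trans hg.symm)]

/-- `R` is the union of finitely many orbits of `M`. -/
def IsFiniteUnionOfOrbits (M : Subgroup (V ≃ₗ[ℂ] V)) (R : Set V) : Prop :=
  ∃ S : Set V, S.Finite ∧ R = ⋃ v ∈ S, MulAction.orbit M v

/-- There is an `M`-invariant subspace `U` of `V`, different from `0` and `V`, such that `R` is
contained in the union of `U` and its orthogonal complement with respect to `B`. -/
def SplitsOrthogonally {σ : ℂ →+* ℂ} (B : V →ₗ[ℂ] V →ₛₗ[σ] ℂ) (M : Subgroup (V ≃ₗ[ℂ] V))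
    (R : Set V) : Prop :=
  ∃ U : Submodule ℂ V, U ≠ ⊥ ∧ U ≠ ⊤ ∧ (∀ g ∈ M, ∀ u ∈ U, g u ∈ U) ∧
    R ⊆ (U : Set V) ∪ (U.orthogonalBilin B : Set V)

/-- The adjoint group `PAut(V, B)`: the isometry group modulo its center. -/
abbrev ProjectiveIsometryGroup {σ : ℂ →+* ℂ} (B : V →ₗ[ℂ] V →ₛₗ[σ] ℂ) : Type _ :=
  isometryGroup B ⧸ Subgroup.center (isometryGroup B)

/-- The image `PM` of a group `M` of isometries in `PAut(V, B)`. -/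
def projectiveImage {σ : ℂ →+* ℂ} (B : V →ₗ[ℂ] V →ₛₗ[σ] ℂ) (M : Subgroup (V ≃ₗ[ℂ] V)) :
    Subgroup (ProjectiveIsometryGroup B) :=
  (M.subgroupOf (isometryGroup B)).map (QuotientGroup.mk' (Subgroup.center (isometryGroup B)))

end

/-! The proof works with the real Lie algebra `L` of `M`: the endomorphisms `X` with `exp (t X)` in
`M` for all real `t`. If `M` is infinite then `L ≠ 0`. Indeed a prime ideal with infinitely many
real zeros has a polynomial vector field tangent to it and not vanishing along it; an integral curve
stays in the zero set, and translating it to the identity gives a nonzero velocity in `L`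
(`exists_curve_of_infinite`, `lieSubmodule_ne_bot`). If `M` is complex algebraic, `L` is a complex
subspace. A subspace `U` with `R ⊆ U ∪ U^⊥` is automatically `M`-invariant
(`splitsOrthogonally_of_subset`), so in each case it is enough to exhibit such a `U`, or to show
that `M` is large.

Alternating case: the closure of the powers of a transvection is a line, so `L` contains `δ ⊗ δ` for
every `δ` in `R`. Take `U` maximal with `Sym² U ⊆ L`. Brackets show that `U` absorbs each `δ` not
orthogonal to it, hence `R ⊆ U ∪ U^⊥`. If `U = V`, then `M` contains all transvections, and these
generate the symplectic group.

Symmetric and Hermitian cases: subtracting `X` in `L` from its conjugate by the reflection along `δ`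
produces an infinitesimal rotation of `δ` into the part of `X δ` orthogonal to `δ`. Let `D` be the
space of `v` orthogonal to `δ` such that `L` contains the rotations of `δ` into all complex
multiples of `v`. If `D ≠ 0`, then `R` lies in the union of `ℂ δ + D` and its orthogonal complement;
so without a splitting `D = δ^⊥` (`mem_rotationSpace_of_orth`). In the symmetric case `M` then moves
`δ`, up to sign, to every vector of norm 2, and so contains all reflections. In the Hermitian case
brackets show that `L`, enlarged by the imaginary scalars, contains every `i w ⊗ w`, so each
quasi-reflection is a scalar times an element of `M`. Reflections, respectively quasi-reflections,
generate the isometry group by an argument of Cartan–Dieudonné type. In the Hermitian case it must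
also be excluded that `L` is made of scalars: determinants on `M` are `n`-th roots of unity. -/

/-! ### Curves in infinite real algebraic sets -/

section RealAlgebraicSets

open MvPolynomial

variable {ι : Type} [Finite ι]

/-- The points of `G` at which all the polynomials of `I` vanish. -/
def zerosIn (G : Set (ι → ℝ)) (I : Ideal (MvPolynomial ι ℝ)) : Set (ι → ℝ) :=
  {z | z ∈ G ∧ ∀ f ∈ I, eval z f = 0}

/-- By Noetherianity there is a maximal ideal among those containing `J` with infinitely many zeros
in `G`. Adjoining a further polynomial leaves finitely many zeros; if a product of two outside
polynomials were in the ideal, its zero set would be a union of two finite sets, so the ideal is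
prime. -/
theorem exists_prime_infinite_zerosIn (G : Set (ι → ℝ)) (J : Ideal (MvPolynomial ι ℝ))
    (hJ : (zerosIn G J).Infinite) :
    ∃ I : Ideal (MvPolynomial ι ℝ), J ≤ I ∧ I.IsPrime ∧ (zerosIn G I).Infinite ∧
      ∀ f ∉ I, {z | z ∈ zerosIn G I ∧ eval z f = 0}.Finite := by
  obtain ⟨I, ⟨hJI, hI⟩, hmax⟩ := set_has_maximal_iff_noetherian.2
    (inferInstance : IsNoetherian (MvPolynomial ι ℝ) (MvPolynomial ι ℝ))
    {I : Ideal (MvPolynomial ι ℝ) | J ≤ I ∧ (zerosIn G I).Infinite} ⟨J, le_rfl, hJ⟩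
  have key : ∀ f ∉ I, {z | z ∈ zerosIn G I ∧ eval z f = 0}.Finite := by
    intro f hf
    by_contra hinf
    refine hmax (I ⊔ Ideal.span {f}) ⟨hJI.trans le_sup_left, Set.Infinite.mono ?_ hinf⟩
      (lt_of_le_of_ne le_sup_left fun h => hf ?_)
    · rintro z ⟨⟨hzG, hz⟩, hzf⟩
      refine ⟨hzG, fun p hp => ?_⟩
      have : I ⊔ Ideal.span {f} ≤ RingHom.ker (eval z) :=
        sup_le (fun q hq => hz q hq) ((Ideal.span_singleton_le_iff_mem _).2 hzf)
      exact this hp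
    · rw [h]
      exact Ideal.mem_sup_right (Ideal.mem_span_singleton_self f)
  refine ⟨I, hJI, ⟨?_, ?_⟩, hI, key⟩
  · intro h
    obtain ⟨z, -, hz⟩ := hI.nonempty
    simpa using hz 1 (h ▸ Submodule.mem_top)
  · intro f g hfg
    by_contra! h
    refine hI (((key f h.1).union (key g h.2)).subset fun z hz => ?_)
    have := hz.2 _ hfg
    rw [map_mul, mul_eq_zero] at this
    exact this.imp (fun h => ⟨hz, h⟩) fun h => ⟨hz, h⟩

/-- A finitely generated transcendental extension of `ℝ` has a nonzero derivation. -/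
theorem exists_derivation_ne_zero (K : Type) [Field K] [Algebra ℝ K]
    [Algebra.EssFiniteType ℝ K] (hK : ¬ Algebra.IsAlgebraic ℝ K) :
    ∃ D : Derivation ℝ K K, D ≠ 0 := by
  by_contra! h
  apply hK
  -- Functionals on the Kähler differentials are derivations, and functionals separate points. So
  -- without derivations `K` is unramified over `ℝ`, hence separable algebraic.
  have : Subsingleton (Ω[K⁄ℝ]) := by
    rw [← not_nontrivial_iff_subsingleton]
    intro hn
    obtain ⟨x, hx⟩ := exists_ne (0 : Ω[K⁄ℝ])
    refine hx ((Module.forall_dual_apply_eq_zero_iff K x).1 fun φ => ?_)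
    have h1 : φ.compDer (KaehlerDifferential.D ℝ K) = 0 := h _
    have h2 : φ = 0 := by
      apply (KaehlerDifferential.linearMapEquivDerivation ℝ K).injective
      rw [map_zero]
      exact h1
    rw [h2, LinearMap.zero_apply]
  have : Algebra.FormallyUnramified ℝ K := ⟨this⟩
  have : Algebra.IsSeparable ℝ K := (Algebra.FormallyUnramified.iff_isSeparable ℝ K).1 this
  infer_instance

/-- The fraction field of the coordinate ring is transcendental over `ℝ`: otherwise each coordinate
would take finitely many values on the zeros. A nonzero derivation of this field, multiplied by a
common denominator of its values on the coordinates, lifts to polynomials. -/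
theorem exists_derivation_preserving (G : Set (ι → ℝ)) (I : Ideal (MvPolynomial ι ℝ))
    [hp : I.IsPrime] (hI : (zerosIn G I).Infinite) :
    ∃ θ : Derivation ℝ (MvPolynomial ι ℝ) (MvPolynomial ι ℝ),
      (∀ f ∈ I, θ f ∈ I) ∧ ∃ i, θ (X i) ∉ I := by
  let B := MvPolynomial ι ℝ ⧸ I
  let K := FractionRing B
  have hess : Algebra.EssFiniteType ℝ K := by
    have : Algebra.EssFiniteType B K := Algebra.EssFiniteType.of_isLocalization K (nonZeroDivisors B)
    exact Algebra.EssFiniteType.comp ℝ B K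
  have halg : ¬ Algebra.IsAlgebraic ℝ K := by
    intro h
    apply hI
    have hpoly : ∀ i, ∃ p : Polynomial ℝ, p ≠ 0 ∧ Polynomial.aeval (X i : MvPolynomial ι ℝ) p ∈ I := by
      intro i
      obtain ⟨p, hp0, hp⟩ := h.isAlgebraic (algebraMap B K (Ideal.Quotient.mk I (X i)))
      refine ⟨p, hp0, ?_⟩
      rw [Polynomial.aeval_algebraMap_apply] at hp
      have h2 := (map_eq_zero_iff _ (IsFractionRing.injective B K)).1 hp
      rw [← Ideal.Quotient.eq_zero_iff_mem]
      have h3 := Polynomial.aeval_algHom_apply (Ideal.Quotient.mkₐ ℝ I) (X i) p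
      rw [Ideal.Quotient.mkₐ_eq_mk] at h3
      rw [← h3]
      exact h2
    choose p hp0 hp using hpoly
    refine (Set.Finite.pi' fun i => (p i).rootSet_finite ℝ).subset fun z hz i => ?_
    rw [Polynomial.mem_rootSet]
    refine ⟨hp0 i, ?_⟩
    have h1 := hz.2 _ (hp i)
    rw [← coe_aeval_eq_eval] at h1
    have h2 := Polynomial.aeval_algHom_apply (aeval z : MvPolynomial ι ℝ →ₐ[ℝ] ℝ) (X i) (p i)
    rw [aeval_X] at h2
    rw [h2]
    exact h1
  obtain ⟨D, hD⟩ := exists_derivation_ne_zero K halg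
  obtain ⟨⟨b, hb⟩, hbD⟩ := IsLocalization.exist_integer_multiples_of_finite (nonZeroDivisors B)
    (fun i => D (algebraMap B K (Ideal.Quotient.mk I (X i))))
  choose c hc using hbD
  choose d hd using fun i => Ideal.Quotient.mk_surjective (c i)
  have hb0 : algebraMap B K b ≠ 0 := by
    rw [Ne, map_eq_zero_iff _ (IsFractionRing.injective B K)]
    exact nonZeroDivisors.ne_zero hb
  let π : MvPolynomial ι ℝ →ₐ[ℝ] K := (IsScalarTower.toAlgHom ℝ B K).comp (Ideal.Quotient.mkₐ ℝ I)
  have hπ : ∀ f, π f = 0 ↔ f ∈ I := fun f => by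
    rw [← Ideal.Quotient.eq_zero_iff_mem]
    exact map_eq_zero_iff _ (IsFractionRing.injective B K)
  let θ : Derivation ℝ (MvPolynomial ι ℝ) (MvPolynomial ι ℝ) := mkDerivation ℝ d
  have hθ : ∀ f, π (θ f) = algebraMap B K b * D (π f) := by
    intro f
    induction f using MvPolynomial.induction_on with
    | C a =>
      have h1 : (C a : MvPolynomial ι ℝ) = algebraMap ℝ _ a := rfl
      rw [h1, Derivation.map_algebraMap, AlgHom.commutes, Derivation.map_algebraMap]
      simp
    | add p q hp hq => rw [map_add, map_add, hp, hq, map_add, map_add, mul_add]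
    | mul_X p i hp =>
      have h1 : π (θ (X i)) = algebraMap B K b * D (π (X i)) := by
        have h2 : θ (X i) = d i := mkDerivation_X _ _ _
        rw [h2]
        have h3 : π (d i) = algebraMap B K (c i) := by rw [← hd i]; rfl
        rw [h3, hc i, Algebra.smul_def]
        rfl
      rw [Derivation.leibniz, map_mul, Derivation.leibniz, map_add]
      simp only [smul_eq_mul, map_mul]
      rw [hp, h1]
      ring
  refine ⟨θ, fun f hf => ?_, ?_⟩
  · rw [← hπ, hθ, (hπ f).2 hf, map_zero, mul_zero]
  · by_contra! hall
    apply hD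
    have hX : ∀ i, D (π (X i)) = 0 := fun i => by
      have := hθ (X i)
      rw [(hπ _).2 (hall i)] at this
      exact (mul_eq_zero.1 this.symm).resolve_left hb0
    have hB : ∀ f, D (π f) = 0 := by
      intro f
      induction f using MvPolynomial.induction_on with
      | C a =>
        have h1 : (C a : MvPolynomial ι ℝ) = algebraMap ℝ _ a := rfl
        rw [h1, AlgHom.commutes, Derivation.map_algebraMap]
      | add p q hp hq => rw [map_add, map_add, hp, hq, add_zero]
      | mul_X p i hp => rw [map_mul, Derivation.leibniz, hp, hX]; simp
    ext x
    obtain ⟨u, v, hv, rfl⟩ := IsFractionRing.div_surjective (A := B) x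
    obtain ⟨u, rfl⟩ := Ideal.Quotient.mk_surjective u
    obtain ⟨v, rfl⟩ := Ideal.Quotient.mk_surjective v
    have e1 : D (algebraMap B K (Ideal.Quotient.mk I u)) = 0 := hB u
    have e2 : D (algebraMap B K (Ideal.Quotient.mk I v)) = 0 := hB v
    rw [Derivation.leibniz_div, e1, e2]
    simp

theorem hasDerivAt_eval_integralCurve {ι : Type} [Fintype ι]
    (θ : Derivation ℝ (MvPolynomial ι ℝ) (MvPolynomial ι ℝ)) {γ : ℝ → ι → ℝ} {t : ℝ}
    (hγ : HasDerivAt γ (fun i => eval (γ t) (θ (X i))) t) (f : MvPolynomial ι ℝ) :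
    HasDerivAt (fun s => eval (γ s) f) (eval (γ t) (θ f)) t := by
  induction f using MvPolynomial.induction_on with
  | C a =>
    have h1 : (C a : MvPolynomial ι ℝ) = algebraMap ℝ _ a := rfl
    have h2 : θ (C a) = 0 := by rw [h1, Derivation.map_algebraMap]
    simpa [h2] using hasDerivAt_const t a
  | add p q hp hq => simpa using hp.fun_add hq
  | mul_X p i hp =>
    have h := hp.fun_mul ((hasDerivAt_pi.1 hγ) i)
    rw [Derivation.leibniz]
    simp only [smul_eq_mul, map_add, map_mul, eval_X]
    rw [add_comm, mul_comm (γ t i)]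
    exact h

/-- An infinite real algebraic set, cut out in an open set, contains a nonconstant `C¹` curve. -/
theorem exists_curve_of_infinite [Fintype ι] (G : Set (ι → ℝ)) (hG : IsOpen G)
    (J : Ideal (MvPolynomial ι ℝ)) (hJ : (zerosIn G J).Infinite) :
    ∃ (γ : ℝ → ι → ℝ) (v : ι → ℝ) (b : ℝ), 0 < b ∧ v ≠ 0 ∧ HasDerivAt γ v 0 ∧
      ∀ t ∈ Set.Icc 0 b, γ t ∈ zerosIn G J := by
  obtain ⟨I, hJI, hprime, hinf, hfin⟩ := exists_prime_infinite_zerosIn G J hJ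
  obtain ⟨θ, hθ, i, hi⟩ := exists_derivation_preserving G I hinf
  -- Start where the vector field does not vanish: its `i`-th component is outside `I`, so has only
  -- finitely many zeros on the set.
  obtain ⟨z, hz, hzi⟩ := (hinf.sdiff (hfin _ hi)).nonempty
  have hzi' : eval z (θ (X i)) ≠ 0 := fun h => hzi ⟨hz, h⟩
  have hsm : ∀ f : MvPolynomial ι ℝ, ContDiff ℝ 1 (fun z => eval z f) := by
    intro f
    induction f using MvPolynomial.induction_on with
    | C a => simpa using contDiff_const
    | add p q hp hq => simpa using hp.add hq
    | mul_X p i hp => simpa using hp.mul (contDiff_apply ℝ ℝ i)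
  have hvf : ContDiff ℝ 1 (fun y : ι → ℝ => fun j => eval y (θ (X j))) :=
    contDiff_pi.2 fun j => hsm _
  obtain ⟨γ, hγ0, ε, hε, hγ⟩ :=
    hvf.contDiffAt.exists_forall_mem_closedBall_exists_eq_forall_mem_Ioo_hasDerivAt₀
      (x₀ := z) (0 : ℝ)
  simp only [zero_sub, zero_add] at hγ
  have h0 : (0 : ℝ) ∈ Set.Ioo (-ε) ε := ⟨by linarith, hε⟩
  have hγc : ContinuousAt γ 0 := (hγ 0 h0).continuousAt
  obtain ⟨η, hη, hηG⟩ := Metric.mem_nhds_iff.1 (hγc (hG.mem_nhds (hγ0 ▸ hz.1)))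
  obtain ⟨b, hb0, hb⟩ := exists_between (lt_min hε hη)
  have hsub : Set.Icc 0 b ⊆ Set.Ioo (-ε) ε := fun t ht =>
    ⟨by linarith [ht.1], lt_of_le_of_lt ht.2 (hb.trans_le (min_le_left _ _))⟩
  obtain ⟨s, hs⟩ := (isNoetherian_def.1 (inferInstance : IsNoetherian (MvPolynomial ι ℝ)
    (MvPolynomial ι ℝ))) I
  have hcoef : ∀ f : s, ∃ a : s → MvPolynomial ι ℝ, θ f.1 = ∑ g : s, a g * g.1 := by
    intro f
    have hf : θ f.1 ∈ Submodule.span (MvPolynomial ι ℝ) (Set.range ((↑) : s → MvPolynomial ι ℝ)) := by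
      rw [Subtype.range_coe_subtype]
      have : {x | x ∈ s} = (s : Set (MvPolynomial ι ℝ)) := rfl
      rw [this, hs]
      exact hθ _ (hs ▸ Submodule.subset_span f.2)
    obtain ⟨a, ha⟩ := (Submodule.mem_span_range_iff_exists_fun _).1 hf
    exact ⟨a, ha.symm⟩
  choose a ha using hcoef
  have hγcont : ContinuousOn γ (Set.Icc 0 b) := fun t ht =>
    (hγ t (hsub ht)).continuousAt.continuousWithinAt
  let F : ℝ → s → ℝ := fun t f => eval (γ t) f.1
  have hF : ∀ t ∈ Set.Icc 0 b, HasDerivAt F (fun f => eval (γ t) (θ f.1)) t := fun t ht =>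
    hasDerivAt_pi.2 fun f => hasDerivAt_eval_integralCurve θ (hγ t (hsub ht)) f.1
  have hbound : ∃ K : ℝ, 0 ≤ K ∧ ∀ t ∈ Set.Icc 0 b, ∀ f g, |eval (γ t) (a f g)| ≤ K := by
    have h1 : ∀ f g : s, ∃ K : ℝ, ∀ t ∈ Set.Icc 0 b, ‖eval (γ t) (a f g)‖ ≤ K := fun f g =>
      isCompact_Icc.exists_bound_of_continuousOn
        ((hsm (a f g)).continuous.comp_continuousOn hγcont)
    choose K hK using h1
    refine ⟨∑ f, ∑ g, |K f g|, Finset.sum_nonneg fun _ _ => Finset.sum_nonneg fun _ _ =>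
      abs_nonneg _, fun t ht f g => (hK f g t ht).trans ((le_abs_self _).trans ?_)⟩
    refine le_trans ?_ (Finset.single_le_sum (f := fun f => ∑ g, |K f g|)
      (fun _ _ => Finset.sum_nonneg fun _ _ => abs_nonneg _) (Finset.mem_univ f))
    exact Finset.single_le_sum (f := fun g => |K f g|) (fun _ _ => abs_nonneg _)
      (Finset.mem_univ g)
  obtain ⟨K, hK0, hK⟩ := hbound
  -- Along the curve the generators of `I` satisfy a homogeneous linear differential system, because
  -- `θ` maps `I` to itself. They vanish at time 0, so Grönwall's inequality keeps them zero.
  have hzero : ∀ t ∈ Set.Icc 0 b, F t = 0 := by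
    refine eq_zero_of_abs_deriv_le_mul_abs_self_of_eq_zero_right
      (K := Fintype.card s * K)
      (f' := fun t f => eval (γ t) (θ f.1))
      (fun t ht => (hF t ht).continuousAt.continuousWithinAt)
      (fun t ht => (hF t (Set.Ico_subset_Icc_self ht)).hasDerivWithinAt) ?_ ?_
    · funext f
      change eval (γ 0) f.1 = 0
      rw [hγ0]
      exact hz.2 _ (hs ▸ Submodule.subset_span f.2)
    · intro t ht
      refine (pi_norm_le_iff_of_nonneg (by positivity)).2 fun f => ?_
      rw [ha f, map_sum]
      refine (norm_sum_le _ _).trans ?_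
      have : ∀ g ∈ (Finset.univ : Finset s), ‖eval (γ t) (a f g * g.1)‖ ≤ K * ‖F t‖ := by
        intro g _
        rw [map_mul, norm_mul]
        exact mul_le_mul (hK t (Set.Ico_subset_Icc_self ht) f g) (norm_le_pi_norm (F t) g)
          (norm_nonneg _) hK0
      refine (Finset.sum_le_sum this).trans ?_
      simp [mul_assoc]
  refine ⟨γ, _, b, hb0, ?_, hγ 0 h0, fun t ht => ⟨?_, fun f hf => ?_⟩⟩
  · intro h
    apply hzi'
    have := congrFun h i
    rwa [hγ0] at this
  · apply hηG
    rw [Metric.mem_ball, Real.dist_eq, sub_zero, abs_of_nonneg ht.1]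
    exact lt_of_le_of_lt ht.2 (hb.trans_le (min_le_right _ _))
  · have : I ≤ RingHom.ker (eval (γ t)) := by
      rw [← hs]
      refine Submodule.span_le.2 fun g hg => ?_
      exact congrFun (hzero t ht) ⟨g, hg⟩
    exact this (hJI hf)

end RealAlgebraicSets

/-! ### The Lie algebra of a real algebraic group of units -/

section PolynomialFunctions

variable {k W : Type*} [Field k] [AddCommGroup W] [Module k W]

theorem dual_mem_polyFunctionAlgebra (φ : Module.Dual k W) :
    (fun w => φ w) ∈ polyFunctionAlgebra k W :=
  Algebra.subset_adjoin ⟨φ, rfl⟩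

theorem const_mem_polyFunctionAlgebra (c : k) : (fun _ => c) ∈ polyFunctionAlgebra k W :=
  (polyFunctionAlgebra k W).algebraMap_mem c

theorem exists_mvPolynomial_of_mem_polyFunctionAlgebra {ι : Type*} (b : Module.Basis ι k W)
    [Finite ι] {f : W → k} (hf : f ∈ polyFunctionAlgebra k W) :
    ∃ p : MvPolynomial ι k, ∀ w, f w = MvPolynomial.eval (b.equivFun w) p := by
  have := Fintype.ofFinite ι
  induction hf using Algebra.adjoin_induction with
  | mem x hx =>
    obtain ⟨φ, rfl⟩ := hx
    refine ⟨∑ i, MvPolynomial.C (φ (b i)) * MvPolynomial.X i, fun w => ?_⟩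
    change φ w = _
    conv_lhs => rw [← b.sum_equivFun w, map_sum]
    simp [mul_comm]
  | algebraMap r => exact ⟨MvPolynomial.C r, fun w => by simp⟩
  | add x y _ _ hx hy =>
    obtain ⟨p, hp⟩ := hx
    obtain ⟨q, hq⟩ := hy
    exact ⟨p + q, fun w => by simp [hp, hq]⟩
  | mul x y _ _ hx hy =>
    obtain ⟨p, hp⟩ := hx
    obtain ⟨q, hq⟩ := hy
    exact ⟨p * q, fun w => by simp [hp, hq]⟩

theorem exists_polynomial_on_line {f : W → k} (hf : f ∈ polyFunctionAlgebra k W) (a b : W) :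
    ∃ p : Polynomial k, ∀ t : k, f (a + t • b) = p.eval t := by
  induction hf using Algebra.adjoin_induction with
  | mem x hx =>
    obtain ⟨φ, rfl⟩ := hx
    exact ⟨Polynomial.C (φ a) + Polynomial.C (φ b) * Polynomial.X, fun t => by
      simp only [map_add, map_smul, smul_eq_mul, Polynomial.eval_add, Polynomial.eval_C,
        Polynomial.eval_mul, Polynomial.eval_X, mul_comm]⟩
  | algebraMap r => exact ⟨Polynomial.C r, fun w => by simp⟩
  | add x y _ _ hx hy =>
    obtain ⟨p, hp⟩ := hx
    obtain ⟨q, hq⟩ := hy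
    exact ⟨p + q, fun w => by simp [hp, hq]⟩
  | mul x y _ _ hx hy =>
    obtain ⟨p, hp⟩ := hx
    obtain ⟨q, hq⟩ := hy
    exact ⟨p * q, fun w => by simp [hp, hq]⟩

/-- A Zariski closed set that contains `a + n b` for all `n : ℕ` contains the line. -/
theorem IsZariskiClosed.line_mem [CharZero k] {Z : Set W} (hZ : IsZariskiClosed k Z) {a b : W}
    (h : ∀ n : ℕ, a + (n : k) • b ∈ Z) (t : k) : a + t • b ∈ Z := by
  obtain ⟨P, hP, rfl⟩ := hZ
  intro p hp
  obtain ⟨q, hq⟩ := exists_polynomial_on_line (hP hp) a b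
  have : q = 0 := Polynomial.eq_zero_of_infinite_isRoot q <|
    (Set.infinite_range_of_injective (Nat.cast_injective (R := k))).mono (by
      rintro _ ⟨n, rfl⟩
      exact (hq n).symm.trans (h n p hp))
  rw [hq, this, Polynomial.eval_zero]

end PolynomialFunctions

theorem continuous_of_mem_polyFunctionAlgebra {W : Type*} [NormedAddCommGroup W]
    [NormedSpace ℝ W] [FiniteDimensional ℝ W] {f : W → ℝ} (hf : f ∈ polyFunctionAlgebra ℝ W) :
    Continuous f := by
  induction hf using Algebra.adjoin_induction with
  | mem x hx =>
    obtain ⟨φ, rfl⟩ := hx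
    exact LinearMap.continuous_of_finiteDimensional φ
  | algebraMap r => exact continuous_const
  | add x y _ _ hx hy => exact hx.add hy
  | mul x y _ _ hx hy => exact hx.mul hy

theorem differentiable_of_mem_polyFunctionAlgebra {W : Type*} [NormedAddCommGroup W]
    [NormedSpace ℂ W] [FiniteDimensional ℂ W] {f : W → ℂ} (hf : f ∈ polyFunctionAlgebra ℂ W) :
    Differentiable ℂ f := by
  induction hf using Algebra.adjoin_induction with
  | mem x hx =>
    obtain ⟨φ, rfl⟩ := hx
    exact (LinearMap.toContinuousLinearMap φ).differentiable
  | algebraMap r => exact differentiable_const _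
  | add x y _ _ hx hy => exact hx.add hy
  | mul x y _ _ hx hy => exact hx.mul hy

theorem IsZariskiClosed.isClosed {W : Type*} [NormedAddCommGroup W]
    [NormedSpace ℝ W] [FiniteDimensional ℝ W] {Z : Set W} (hZ : IsZariskiClosed ℝ Z) :
    IsClosed Z := by
  obtain ⟨P, hP, rfl⟩ := hZ
  simp only [Set.ofPred_forall]
  exact isClosed_biInter fun p hp =>
    isClosed_eq (continuous_of_mem_polyFunctionAlgebra (hP hp)) continuous_const

/-! ### One-parameter subgroups of an algebraic group of units -/

section LieAlgebra

open NormedSpace Filter Topology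

variable {A : Type*} [NormedRing A] [NormedAlgebra ℝ A]

/-- A submonoid which is a group of units, cut out among the units by real polynomials. -/
structure IsAlgebraicUnitGroup (S : Submonoid A) : Prop where
  exists_inv : ∀ a ∈ S, ∃ b ∈ S, a * b = 1 ∧ b * a = 1
  exists_closed : ∃ Z : Set A, IsZariskiClosed ℝ Z ∧ ∀ a, IsUnit a → (a ∈ S ↔ a ∈ Z)

/-- The generators of the one-parameter groups in `S`. -/
def lieSet (S : Submonoid A) : Set A := {x | ∀ t : ℝ, exp (t • x) ∈ S}

variable {S : Submonoid A}

theorem IsAlgebraicUnitGroup.isUnit (hS : IsAlgebraicUnitGroup S) {a : A} (ha : a ∈ S) :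
    IsUnit a := by
  obtain ⟨b, -, h1, h2⟩ := hS.exists_inv a ha
  exact ⟨⟨a, b, h1, h2⟩, rfl⟩

variable [FiniteDimensional ℝ A]

theorem exp_mul_exp_neg' (x : A) : exp x * exp (-x) = 1 := by
  have := FiniteDimensional.complete ℝ A
  have := NormedAlgebra.restrictScalars ℚ ℝ A
  rw [← exp_add_of_commute (Commute.refl x).neg_right, add_neg_cancel, exp_zero]

theorem isUnit_exp' (x : A) : IsUnit (exp x) := by
  refine ⟨⟨exp x, exp (-x), exp_mul_exp_neg' x, ?_⟩, rfl⟩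
  have := exp_mul_exp_neg' (-x)
  rwa [neg_neg] at this

namespace IsAlgebraicUnitGroup

/-- `S` is closed only relative to the units; the limit causes no trouble because an exponential is
a unit. -/
theorem exp_mem_of_tendsto (hS : IsAlgebraicUnitGroup S) {u : ℕ → A} {x : A}
    (hu : ∀ᶠ n in atTop, u n ∈ S) (h : Tendsto u atTop (𝓝 (exp x))) : exp x ∈ S := by
  obtain ⟨Z, hZ, hSZ⟩ := hS.exists_closed
  exact (hSZ _ (isUnit_exp' x)).2 (hZ.isClosed.mem_of_tendsto h
    (hu.mono fun n hn => (hSZ _ (hS.isUnit hn)).1 hn))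

theorem exp_neg_mem (hS : IsAlgebraicUnitGroup S) {x : A} (hx : exp x ∈ S) : exp (-x) ∈ S := by
  obtain ⟨b, hb, -, h2⟩ := hS.exists_inv _ hx
  have : exp (-x) = b := by
    rw [← one_mul (exp (-x)), ← h2, mul_assoc, exp_mul_exp_neg', mul_one]
  rwa [this]

/-- `exp x` is the limit of `c (1 / n) ^ n`: with `l` a local inverse of the exponential, this power
is `exp (n l (c (1 / n)))`, and `n l (c (1 / n))` tends to the velocity `x`. -/
theorem exp_mem_of_hasDerivAt (hS : IsAlgebraicUnitGroup S) {c : ℝ → A} {x : A} {b : ℝ}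
    (hb : 0 < b) (hc0 : c 0 = 1) (hd : HasDerivAt c x 0) (hc : ∀ t ∈ Set.Icc 0 b, c t ∈ S) :
    exp x ∈ S := by
  have := FiniteDimensional.complete ℝ A
  have := NormedAlgebra.restrictScalars ℚ ℝ A
  have hexp : HasStrictFDerivAt (exp : A → A) ((ContinuousLinearEquiv.refl ℝ A : A ≃L[ℝ] A) : A →L[ℝ] A) 0 :=
    hasStrictFDerivAt_exp_zero (𝕂 := ℝ)
  set l := hexp.localInverse with hl
  have hl1 : HasDerivAt (fun t => l (c t)) x 0 := by
    have h1 : HasFDerivAt l ((ContinuousLinearEquiv.refl ℝ A : A ≃L[ℝ] A) : A →L[ℝ] A) (c 0) := by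
      have := hexp.to_localInverse.hasFDerivAt
      rw [exp_zero] at this
      rw [hc0]
      exact this
    exact h1.comp_hasDerivAt 0 hd
  have hl0 : l (c 0) = 0 := by
    have := hexp.localInverse_apply_image
    rw [exp_zero] at this
    rw [hc0]
    exact this
  have hr : ∀ᶠ t in 𝓝 (0 : ℝ), exp (l (c t)) = c t := by
    have := hexp.eventually_right_inverse
    rw [exp_zero, ← hc0] at this
    exact hd.continuousAt.eventually this
  have hseq : Tendsto (fun n : ℕ => ((n : ℝ) + 1)⁻¹) atTop (𝓝[≠] 0) := by
    refine tendsto_nhdsWithin_iff.2 ⟨by simpa using tendsto_one_div_add_atTop_nhds_zero_nat (𝕜 := ℝ), ?_⟩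
    exact Eventually.of_forall fun n => by
      have : (n : ℝ) + 1 ≠ 0 := by positivity
      simpa using this
  have hslope := (hasDerivAt_iff_tendsto_slope_zero.1 hl1).comp hseq
  have hlim := ((exp_continuous (𝔸 := A)).tendsto x).comp hslope
  refine hS.exp_mem_of_tendsto (u := fun n : ℕ => c ((n : ℝ) + 1)⁻¹ ^ (n + 1)) ?_ (hlim.congr' ?_)
  · have h1 : ∀ᶠ n : ℕ in atTop, ((n : ℝ) + 1)⁻¹ < b :=
      (hseq.mono_right nhdsWithin_le_nhds).eventually (gt_mem_nhds hb)
    filter_upwards [h1] with n hn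
    exact pow_mem (hc _ ⟨by positivity, hn.le⟩) _
  · filter_upwards [(hseq.mono_right nhdsWithin_le_nhds).eventually hr] with n hn
    simp only [Function.comp_apply, zero_add, hl0, sub_zero, inv_inv]
    rw [← hn, ← exp_nsmul, hn]
    congr 1
    rw [← Nat.cast_smul_eq_nsmul ℝ, Nat.cast_add, Nat.cast_one]

theorem mem_lieSet_of_hasDerivAt (hS : IsAlgebraicUnitGroup S) {c : ℝ → A} {x : A} {b : ℝ}
    (hb : 0 < b) (hc0 : c 0 = 1) (hd : HasDerivAt c x 0) (hc : ∀ t ∈ Set.Icc 0 b, c t ∈ S) :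
    x ∈ lieSet S := by
  have key : ∀ t : ℝ, 0 ≤ t → exp (t • x) ∈ S := by
    intro t ht
    -- Dividing by `t + 1` instead of `t` keeps `t * s ≤ b` and covers `t = 0`.
    refine hS.exp_mem_of_hasDerivAt (c := fun s => c (t * s)) (b := b / (t + 1)) (by positivity)
      (by simpa using hc0) ?_ fun s hs => hc _ ⟨mul_nonneg ht hs.1, ?_⟩
    · have h1 : HasDerivAt (fun s : ℝ => t * s) t 0 := by
        simpa using (hasDerivAt_id (0 : ℝ)).const_mul t
      have h2 : HasDerivAt c x (t * 0) := by simpa using hd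
      exact h2.scomp 0 h1
    · have h1 := (le_div_iff₀ (by positivity : 0 < t + 1)).1 hs.2
      nlinarith [hs.1]
  intro t
  rcases le_total 0 t with ht | ht
  · exact key t ht
  · have := hS.exp_neg_mem (key (-t) (by linarith))
    rwa [← neg_smul, neg_neg] at this

theorem hasDerivAt_exp_smul_zero (x : A) : HasDerivAt (fun t : ℝ => exp (t • x)) x 0 := by
  have := FiniteDimensional.complete ℝ A
  have := NormedAlgebra.restrictScalars ℚ ℝ A
  simpa using hasDerivAt_exp_smul_const (𝕂 := ℝ) x 0

/-- The Lie algebra of an algebraic group of units, as a real subspace. -/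
def lieSubmodule (hS : IsAlgebraicUnitGroup S) : Submodule ℝ A where
  carrier := lieSet S
  zero_mem' := fun t => by
    rw [smul_zero, exp_zero]
    exact S.one_mem
  add_mem' := by
    intro x y hx hy
    refine hS.mem_lieSet_of_hasDerivAt (c := fun t => exp (t • x) * exp (t • y)) one_pos
      (by simp) ?_ fun t _ => S.mul_mem (hx t) (hy t)
    simpa [add_comm] using (hasDerivAt_exp_smul_zero x).fun_mul (hasDerivAt_exp_smul_zero y)
  smul_mem' := fun r x hx t => by
    rw [smul_smul]
    exact hx _

theorem conj_mem_lieSubmodule (hS : IsAlgebraicUnitGroup S) {a b x : A} (ha : a ∈ S)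
    (hab : a * b = 1) (hba : b * a = 1) (hx : x ∈ hS.lieSubmodule) :
    a * x * b ∈ hS.lieSubmodule := by
  have := FiniteDimensional.complete ℝ A
  have := NormedAlgebra.restrictScalars ℚ ℝ A
  intro t
  have h := exp_units_conj (⟨a, b, hab, hba⟩ : Aˣ) (t • x)
  simp only [Units.inv_mk] at h
  have e : a * (t • x) * b = t • (a * x * b) := by rw [mul_smul_comm, smul_mul_assoc]
  rw [e] at h
  rw [h]
  have hb : b ∈ S := by
    obtain ⟨b', hb', -, h2⟩ := hS.exists_inv a ha
    have : b = b' := by rw [← one_mul b, ← h2, mul_assoc, hab, mul_one]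
    rwa [this]
  exact S.mul_mem (S.mul_mem ha (hx t)) hb

/-- The bracket is the derivative at 0 of the conjugates of `y` by `exp (t x)`; the difference
quotients lie in a finite-dimensional, hence closed, subspace. -/
theorem bracket_mem_lieSubmodule (hS : IsAlgebraicUnitGroup S) {x y : A}
    (hx : x ∈ hS.lieSubmodule) (hy : y ∈ hS.lieSubmodule) :
    x * y - y * x ∈ hS.lieSubmodule := by
  have h1 : HasDerivAt (fun t : ℝ => exp (t • x) * y * exp (t • -x)) (x * y - y * x) 0 := by
    have := ((hasDerivAt_exp_smul_zero x).mul_const y).fun_mul (hasDerivAt_exp_smul_zero (-x))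
    simpa [sub_eq_add_neg] using this
  have hcl : IsClosed (hS.lieSubmodule : Set A) := Submodule.closed_of_finiteDimensional _
  have hmem : ∀ t : ℝ, exp (t • x) * y * exp (t • -x) ∈ hS.lieSubmodule := fun t => by
    refine hS.conj_mem_lieSubmodule (hx t) ?_ ?_ hy
    · rw [smul_neg, exp_mul_exp_neg']
    · have := exp_mul_exp_neg' (-(t • x))
      rwa [neg_neg, ← smul_neg] at this
  have h2 := (hasDerivAt_iff_tendsto_slope_zero.1 h1)
  refine hcl.mem_of_tendsto h2 (Eventually.of_forall fun t => ?_)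
  exact Submodule.smul_mem _ _ (Submodule.sub_mem _ (hmem _) (hmem _))

theorem lieSubmodule_ne_bot (hS : IsAlgebraicUnitGroup S) (hinf : (S : Set A).Infinite) :
    hS.lieSubmodule ≠ ⊥ := by
  have := FiniteDimensional.complete ℝ A
  obtain ⟨Z, ⟨P, hP, rfl⟩, hSZ⟩ := hS.exists_closed
  let b := Module.finBasis ℝ A
  let e := b.equivFun.toContinuousLinearEquiv
  choose q hq using fun p : P => exists_mvPolynomial_of_mem_polyFunctionAlgebra b (hP p.2)
  let J : Ideal (MvPolynomial (Fin (Module.finrank ℝ A)) ℝ) := Ideal.span (Set.range q)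
  let G : Set (Fin (Module.finrank ℝ A) → ℝ) := e.symm ⁻¹' {a | IsUnit a}
  have hG : IsOpen G := Units.isOpen.preimage e.symm.continuous
  have hmem : ∀ z, z ∈ zerosIn G J ↔ e.symm z ∈ S := by
    intro z
    constructor
    · rintro ⟨hz, h⟩
      refine (hSZ _ hz).2 fun p hp => ?_
      have h1 := hq ⟨p, hp⟩ (e.symm z)
      have h2 : b.equivFun (e.symm z) = z := e.apply_symm_apply z
      rw [h2] at h1
      exact h1.trans (h _ (Ideal.subset_span ⟨_, rfl⟩))
    · intro hz
      refine ⟨hS.isUnit hz, fun f hf => ?_⟩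
      have : J ≤ RingHom.ker (MvPolynomial.eval z) := by
        refine Ideal.span_le.2 ?_
        rintro _ ⟨p, rfl⟩
        have h1 := hq p (e.symm z)
        have h2 : b.equivFun (e.symm z) = z := e.apply_symm_apply z
        rw [h2] at h1
        exact h1.symm.trans ((hSZ _ (hS.isUnit hz)).1 hz _ p.2)
      exact this hf
  have hJ : (zerosIn G J).Infinite := by
    have : zerosIn G J = e.symm ⁻¹' (S : Set A) := Set.ext hmem
    rw [this]
    exact hinf.preimage (by rw [e.symm.surjective.range_eq]; exact Set.subset_univ _)
  obtain ⟨γ, v, c, hc, hv, hd, hγ⟩ := exists_curve_of_infinite G hG J hJ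
  have hd' : HasDerivAt (fun t => e.symm (γ t)) (e.symm v) 0 :=
    e.symm.hasFDerivAt.comp_hasDerivAt 0 hd
  have h0 : e.symm (γ 0) ∈ S := (hmem _).1 (hγ 0 ⟨le_rfl, hc.le⟩)
  obtain ⟨a, ha, h1, h2⟩ := hS.exists_inv _ h0
  -- Multiplying by the inverse of the starting point moves the curve to the identity.
  have hx : a * e.symm v ∈ hS.lieSubmodule :=
    hS.mem_lieSet_of_hasDerivAt (c := fun t => a * e.symm (γ t)) hc h2 (hd'.const_mul a)
      fun t ht => S.mul_mem ha ((hmem _).1 (hγ t ht))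
  intro hbot
  rw [hbot, Submodule.mem_bot] at hx
  have : e.symm v = 0 := by
    rw [← one_mul (e.symm v), ← h1, mul_assoc, hx, mul_zero]
  exact hv ((map_eq_zero_iff e.symm e.symm.injective).1 this)

theorem mem_lieSubmodule_of_line (hS : IsAlgebraicUnitGroup S) {x : A}
    (h : ∀ t : ℝ, 1 + t • x ∈ S) : x ∈ hS.lieSubmodule := by
  refine hS.mem_lieSet_of_hasDerivAt (c := fun t => 1 + t • x) one_pos (by simp) ?_ fun t _ => h t
  simpa using ((hasDerivAt_id (0 : ℝ)).smul_const x).const_add 1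

end IsAlgebraicUnitGroup

end LieAlgebra

/-! ### Complex algebraic groups, and the exponential series tested on functionals -/

section ComplexAlgebra

open NormedSpace Filter Topology

variable {A : Type*} [NormedRing A] [NormedAlgebra ℂ A] [FiniteDimensional ℂ A]

/-- For each defining polynomial `p` the entire function `z ↦ p (exp (z x))` vanishes on the real
axis, hence everywhere, in particular at `i t`. -/
theorem IsAlgebraicUnitGroup.I_smul_mem_lieSubmodule {S : Submonoid A}
    (hS : IsAlgebraicUnitGroup S)
    (hSZ : ∃ Z : Set A, IsZariskiClosed ℂ Z ∧ ∀ a, IsUnit a → (a ∈ S ↔ a ∈ Z)) {x : A}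
    (hx : x ∈ hS.lieSubmodule) : Complex.I • x ∈ hS.lieSubmodule := by
  have := FiniteDimensional.complete ℂ A
  have := NormedAlgebra.restrictScalars ℚ ℂ A
  obtain ⟨Z, ⟨P, hP, rfl⟩, hSZ⟩ := hSZ
  intro t
  refine (hSZ _ (isUnit_exp' _)).2 fun p hp => ?_
  have hdiff : Differentiable ℂ (fun z : ℂ => p (exp (z • x))) :=
    (differentiable_of_mem_polyFunctionAlgebra (hP hp)).comp fun z =>
      (hasDerivAt_exp_smul_const (𝕂 := ℂ) x z).differentiableAt
  have hzero : ∀ s : ℝ, p (exp ((s : ℂ) • x)) = 0 := fun s =>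
    (hSZ _ (isUnit_exp' _)).1 (hx s) p hp
  have hseq : Tendsto (fun n : ℕ => (((n : ℝ) + 1)⁻¹ : ℝ)) atTop (𝓝 0) := by
    simpa using tendsto_one_div_add_atTop_nhds_zero_nat (𝕜 := ℝ)
  have hseq' : Tendsto (fun n : ℕ => ((((n : ℝ) + 1)⁻¹ : ℝ) : ℂ)) atTop (𝓝[≠] 0) := by
    refine tendsto_nhdsWithin_iff.2
      ⟨(Complex.continuous_ofReal.tendsto' 0 0 Complex.ofReal_zero).comp hseq, ?_⟩
    exact Eventually.of_forall fun n => by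
      have : ((n : ℝ) + 1)⁻¹ ≠ 0 := by positivity
      exact Complex.ofReal_ne_zero.2 this
  have hfreq : ∃ᶠ z in 𝓝[≠] (0 : ℂ), p (exp (z • x)) = 0 :=
    hseq'.frequently (Frequently.of_forall fun n => hzero _)
  have := AnalyticOnNhd.eq_of_frequently_eq
    (f := fun z : ℂ => p (exp (z • x))) (g := fun _ => 0) (z₀ := 0)
    (fun z _ => hdiff.analyticAt z) (fun z _ => analyticAt_const) hfreq
  have h2 := congrFun this ((t : ℂ) * Complex.I)
  rw [mul_smul] at h2
  exact h2

theorem hasSum_dual_exp (φ : A →ₗ[ℂ] ℂ) (x : A) :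
    HasSum (fun n : ℕ => (n.factorial : ℂ)⁻¹ * φ (x ^ n)) (φ (exp x)) := by
  have := FiniteDimensional.complete ℂ A
  have := NormedAlgebra.restrictScalars ℚ ℂ A
  have h := exp_series_hasSum_exp' (𝕂 := ℂ) x
  simpa using (LinearMap.toContinuousLinearMap φ).hasSum h

theorem dual_exp_of_geometric (φ : A →ₗ[ℂ] ℂ) {x : A} {μ c : ℂ} (h : ∀ n : ℕ, φ (x ^ n) = μ ^ n * c) :
    φ (exp x) = Complex.exp μ * c := by
  refine (hasSum_dual_exp φ x).unique ?_
  have h1 := (exp_series_hasSum_exp' (𝕂 := ℂ) μ).mul_right c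
  rw [← Complex.exp_eq_exp_ℂ] at h1
  refine h1.congr_fun fun n => ?_
  rw [h n, smul_eq_mul, mul_assoc]

theorem dual_exp_of_sq_zero (φ : A →ₗ[ℂ] ℂ) {x : A} (h : ∀ n : ℕ, φ (x ^ (n + 2)) = 0) :
    φ (exp x) = φ 1 + φ x := by
  refine (hasSum_dual_exp φ x).unique ?_
  have h1 := hasSum_sum_of_ne_finset_zero (L := SummationFilter.unconditional ℕ)
    (s := Finset.range 2)
    (f := fun n : ℕ => (n.factorial : ℂ)⁻¹ * φ (x ^ n)) (fun n hn => by
      obtain ⟨m, rfl⟩ := Nat.exists_eq_add_of_le' (not_lt.1 (fun h => hn (Finset.mem_range.2 h)))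
      simp only [h m, mul_zero])
  simpa [Finset.sum_range_succ] using h1

end ComplexAlgebra

/-! ### The Lie algebra of an algebraic subgroup of `GL(V)` -/

section AlgebraicSubgroup

variable {V : Type*} [AddCommGroup V] [Module ℂ V]

/-- The properties of the Lie algebra `L` of a subgroup `M` of `GL(V)` that do not mention the
topology of `End(V)`. -/
structure IsLieAlgebraOf (M : Subgroup (V ≃ₗ[ℂ] V)) (L : Submodule ℝ (Module.End ℂ V)) : Prop where
  conj_mem : ∀ g ∈ M, ∀ X ∈ L,
    (g : V →ₗ[ℂ] V) * X * ((g⁻¹ : V ≃ₗ[ℂ] V) : V →ₗ[ℂ] V) ∈ L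
  bracket_mem : ∀ X ∈ L, ∀ Y ∈ L, X * Y - Y * X ∈ L
  ne_bot : Infinite M → L ≠ ⊥
  I_smul_mem : IsAlgebraicSubgroup ℂ M → ∀ X ∈ L, Complex.I • X ∈ L
  mem_of_line : ∀ X : Module.End ℂ V, (∀ t : ℝ, ∃ g ∈ M, (g : V →ₗ[ℂ] V) = 1 + t • X) → X ∈ L
  deriv_eq : ∀ φ ψ : Module.End ℂ V →ₗ[ℝ] ℂ,
    (∀ g ∈ M, φ (g : V →ₗ[ℂ] V) = ψ ((g⁻¹ : V ≃ₗ[ℂ] V) : V →ₗ[ℂ] V)) → ∀ X ∈ L, φ X = -ψ X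
  exists_exp : ∀ X ∈ L, ∃ g ∈ M, (∀ x (μ : ℂ), X x = μ • x → g x = Complex.exp μ • x) ∧
    ∀ x, X (X x) = 0 → g x = x + X x

/-- A normed ring structure on the endomorphisms of a finite-dimensional complex vector space. -/
@[reducible]
noncomputable def endNormedRing [FiniteDimensional ℂ V] : NormedRing (Module.End ℂ V) :=
  letI : NormedRing (Matrix (Fin (Module.finrank ℂ V)) (Fin (Module.finrank ℂ V)) ℂ) :=
    Matrix.linftyOpNormedRing
  NormedRing.induced _ _ (LinearMap.toMatrixAlgEquiv (Module.finBasis ℂ V))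
    (LinearMap.toMatrixAlgEquiv (Module.finBasis ℂ V)).injective

attribute [local instance] endNormedRing

/-- The normed algebra structure that goes with `endNormedRing`. -/
@[reducible]
noncomputable def endNormedAlgebra [FiniteDimensional ℂ V] : NormedAlgebra ℂ (Module.End ℂ V) :=
  letI : NormedRing (Matrix (Fin (Module.finrank ℂ V)) (Fin (Module.finrank ℂ V)) ℂ) :=
    Matrix.linftyOpNormedRing
  letI : NormedAlgebra ℂ (Matrix (Fin (Module.finrank ℂ V)) (Fin (Module.finrank ℂ V)) ℂ) :=
    Matrix.linftyOpNormedAlgebra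
  NormedAlgebra.induced ℂ _ _ (LinearMap.toMatrixAlgEquiv (Module.finBasis ℂ V))

attribute [local instance] endNormedAlgebra

/-- The endomorphisms underlying the elements of `M`. -/
def Subgroup.toEndSubmonoid (M : Subgroup (V ≃ₗ[ℂ] V)) : Submonoid (Module.End ℂ V) :=
  M.toSubmonoid.map LinearEquiv.automorphismGroup.toLinearMapMonoidHom

theorem Subgroup.mem_toEndSubmonoid {M : Subgroup (V ≃ₗ[ℂ] V)} {f : Module.End ℂ V} :
    f ∈ M.toEndSubmonoid ↔ ∃ g ∈ M, (g : V →ₗ[ℂ] V) = f := Iff.rfl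

theorem coe_mul_coe_inv (g : V ≃ₗ[ℂ] V) :
    (g : V →ₗ[ℂ] V) * ((g⁻¹ : V ≃ₗ[ℂ] V) : V →ₗ[ℂ] V) = 1 :=
  LinearMap.ext fun x => g.apply_symm_apply x

theorem coe_inv_mul_coe (g : V ≃ₗ[ℂ] V) :
    ((g⁻¹ : V ≃ₗ[ℂ] V) : V →ₗ[ℂ] V) * (g : V →ₗ[ℂ] V) = 1 :=
  LinearMap.ext fun x => g.symm_apply_apply x

theorem mem_toEndSubmonoid_iff_of_isUnit {M : Subgroup (V ≃ₗ[ℂ] V)} {Z : Set (Module.End ℂ V)}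
    (h : ∀ g : V ≃ₗ[ℂ] V, g ∈ M ↔ (g : V →ₗ[ℂ] V) ∈ Z) {a : Module.End ℂ V} (ha : IsUnit a) :
    a ∈ M.toEndSubmonoid ↔ a ∈ Z := by
  rw [Subgroup.mem_toEndSubmonoid]
  constructor
  · rintro ⟨g, hg, rfl⟩
    exact (h g).1 hg
  · intro haZ
    obtain ⟨g, hg⟩ : ∃ g : V ≃ₗ[ℂ] V, (g : V →ₗ[ℂ] V) = a :=
      ⟨LinearEquiv.ofBijective a ((Module.End.isUnit_iff a).1 ha), LinearMap.ext fun x => rfl⟩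
    exact ⟨g, (h g).2 (hg ▸ haZ), hg⟩

theorem isAlgebraicUnitGroup_toEndSubmonoid [FiniteDimensional ℂ V] {M : Subgroup (V ≃ₗ[ℂ] V)}
    (hM : IsAlgebraicSubgroup ℝ M) : IsAlgebraicUnitGroup M.toEndSubmonoid where
  exists_inv := by
    rintro _ ⟨g, hg, rfl⟩
    exact ⟨_, ⟨g⁻¹, M.inv_mem hg, rfl⟩, coe_mul_coe_inv g, coe_inv_mul_coe g⟩
  exists_closed := by
    obtain ⟨Z, hZ, h⟩ := hM
    exact ⟨Z, hZ, fun a ha => mem_toEndSubmonoid_iff_of_isUnit h ha⟩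

theorem exp_apply_of_eigenvector [FiniteDimensional ℂ V] {X : Module.End ℂ V} {x : V} {μ : ℂ}
    (h : X x = μ • x) : NormedSpace.exp X x = Complex.exp μ • x := by
  rw [← sub_eq_zero, ← Module.forall_dual_apply_eq_zero_iff ℂ]
  intro f
  rw [map_sub, sub_eq_zero, map_smul, smul_eq_mul]
  refine dual_exp_of_geometric (f ∘ₗ LinearMap.applyₗ (R := ℂ) x) fun n => ?_
  have : ∀ n : ℕ, (X ^ n) x = μ ^ n • x := by
    intro n
    induction n with
    | zero => simp
    | succ n ih => rw [pow_succ, Module.End.mul_apply, h, map_smul, ih, smul_smul, pow_succ']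
  simp [this n]

theorem exp_apply_of_sq_zero [FiniteDimensional ℂ V] {X : Module.End ℂ V} {x : V}
    (h : X (X x) = 0) : NormedSpace.exp X x = x + X x := by
  rw [← sub_eq_zero, ← Module.forall_dual_apply_eq_zero_iff ℂ]
  intro f
  rw [map_sub, sub_eq_zero, map_add]
  refine dual_exp_of_sq_zero (f ∘ₗ LinearMap.applyₗ (R := ℂ) x) fun n => ?_
  rw [pow_add, pow_two]
  simp [h]

theorem exists_isLieAlgebraOf [FiniteDimensional ℂ V] {M : Subgroup (V ≃ₗ[ℂ] V)}
    (hM : IsAlgebraicSubgroup ℝ M) : ∃ L, IsLieAlgebraOf M L := by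
  have hS := isAlgebraicUnitGroup_toEndSubmonoid hM
  refine ⟨hS.lieSubmodule, ⟨?_, ?_, ?_, ?_, ?_, ?_, ?_⟩⟩
  · intro g hg X hX
    exact hS.conj_mem_lieSubmodule ⟨g, hg, rfl⟩ (coe_mul_coe_inv g) (coe_inv_mul_coe g) hX
  · intro X hX Y hY
    exact hS.bracket_mem_lieSubmodule hX hY
  · intro hinf
    refine hS.lieSubmodule_ne_bot ?_
    have : (M.toEndSubmonoid : Set (Module.End ℂ V)) =
        (fun g : V ≃ₗ[ℂ] V => (g : V →ₗ[ℂ] V)) '' (M : Set (V ≃ₗ[ℂ] V)) := rfl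
    rw [this]
    exact (Set.infinite_coe_iff.1 hinf).image LinearEquiv.toLinearMap_injective.injOn
  · rintro ⟨Z, hZ, h⟩ X hX
    exact hS.I_smul_mem_lieSubmodule ⟨Z, hZ, fun a ha => mem_toEndSubmonoid_iff_of_isUnit h ha⟩ hX
  · intro X hX
    exact hS.mem_lieSubmodule_of_line fun t => hX t
  · intro φ ψ h X hX
    -- On the one-parameter group of `X` the hypothesis reads `φ (exp (t X)) = ψ (exp (-t X))`;
    -- differentiate at 0.
    have h1 : HasDerivAt (fun t : ℝ => φ (NormedSpace.exp (t • X))) (φ X) 0 :=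
      (LinearMap.toContinuousLinearMap φ).hasFDerivAt.comp_hasDerivAt 0
        (IsAlgebraicUnitGroup.hasDerivAt_exp_smul_zero X)
    have h2 : HasDerivAt (fun t : ℝ => ψ (NormedSpace.exp (t • -X))) (ψ (-X)) 0 :=
      (LinearMap.toContinuousLinearMap ψ).hasFDerivAt.comp_hasDerivAt 0
        (IsAlgebraicUnitGroup.hasDerivAt_exp_smul_zero (-X))
    have h3 : (fun t : ℝ => φ (NormedSpace.exp (t • X))) =
        fun t : ℝ => ψ (NormedSpace.exp (t • -X)) := by
      funext t
      obtain ⟨g, hg, hgX⟩ := hX t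
      have hgX' : (g : V →ₗ[ℂ] V) = NormedSpace.exp (t • X) := hgX
      rw [← hgX', h g hg]
      congr 1
      calc ((g⁻¹ : V ≃ₗ[ℂ] V) : V →ₗ[ℂ] V)
          = ((g⁻¹ : V ≃ₗ[ℂ] V) : V →ₗ[ℂ] V) * ((g : V →ₗ[ℂ] V) * NormedSpace.exp (t • -X)) := by
            rw [hgX', smul_neg, exp_mul_exp_neg', mul_one]
        _ = NormedSpace.exp (t • -X) := by rw [← mul_assoc, coe_inv_mul_coe, one_mul]
    rw [h3] at h1
    rw [h1.unique h2, map_neg]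
  · intro X hX
    obtain ⟨g, hg, hgX⟩ := hX 1
    have hgX' : (g : V →ₗ[ℂ] V) = NormedSpace.exp X := by
      rw [one_smul] at hgX
      exact hgX
    refine ⟨g, hg, fun x μ h => ?_, fun x h => ?_⟩
    · rw [← exp_apply_of_eigenvector h, ← hgX']
      rfl
    · rw [← exp_apply_of_sq_zero h, ← hgX']
      rfl

end AlgebraicSubgroup

/-! ### Zariski closed subgroups -/

section ZariskiClosed

theorem IsZariskiClosed.inter {k W : Type*} [Field k] [AddCommGroup W] [Module k W] {S T : Set W}
    (hS : IsZariskiClosed k S) (hT : IsZariskiClosed k T) : IsZariskiClosed k (S ∩ T) := by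
  obtain ⟨P, hP, rfl⟩ := hS
  obtain ⟨P', hP', rfl⟩ := hT
  refine ⟨P ∪ P', Set.union_subset hP hP', ?_⟩
  ext w
  constructor
  · rintro ⟨h1, h2⟩ p (hp | hp)
    · exact h1 p hp
    · exact h2 p hp
  · exact fun h => ⟨fun p hp => h p (Or.inl hp), fun p hp => h p (Or.inr hp)⟩

variable {W : Type*} [AddCommGroup W] [Module ℂ W]

/-- A complex-valued function whose real and imaginary parts are real polynomial functions. -/
def IsRealPolynomial (f : W → ℂ) : Prop :=
  (fun w => (f w).re) ∈ polyFunctionAlgebra ℝ W ∧ (fun w => (f w).im) ∈ polyFunctionAlgebra ℝ W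

namespace IsRealPolynomial

theorem const (c : ℂ) : IsRealPolynomial (fun _ : W => c) :=
  ⟨const_mem_polyFunctionAlgebra c.re, const_mem_polyFunctionAlgebra c.im⟩

theorem add {f g : W → ℂ} (hf : IsRealPolynomial f) (hg : IsRealPolynomial g) :
    IsRealPolynomial (fun w => f w + g w) :=
  ⟨Subalgebra.add_mem _ hf.1 hg.1, Subalgebra.add_mem _ hf.2 hg.2⟩

theorem mul {f g : W → ℂ} (hf : IsRealPolynomial f) (hg : IsRealPolynomial g) :
    IsRealPolynomial (fun w => f w * g w) :=
  ⟨Subalgebra.sub_mem _ (Subalgebra.mul_mem _ hf.1 hg.1) (Subalgebra.mul_mem _ hf.2 hg.2),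
    Subalgebra.add_mem _ (Subalgebra.mul_mem _ hf.1 hg.2) (Subalgebra.mul_mem _ hf.2 hg.1)⟩

theorem star {f : W → ℂ} (hf : IsRealPolynomial f) :
    IsRealPolynomial (fun w => starRingEnd ℂ (f w)) :=
  ⟨hf.1, Subalgebra.neg_mem _ hf.2⟩

theorem sum {ι : Type*} (s : Finset ι) {f : ι → W → ℂ} (hf : ∀ i, IsRealPolynomial (f i)) :
    IsRealPolynomial (fun w => ∑ i ∈ s, f i w) := by
  classical
  induction s using Finset.induction_on with
  | empty => simpa using const (W := W) 0
  | insert i s hi ih =>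
    simp only [Finset.sum_insert hi]
    exact (hf i).add ih

theorem of_mem {f : W → ℂ} (hf : f ∈ polyFunctionAlgebra ℂ W) : IsRealPolynomial f := by
  induction hf using Algebra.adjoin_induction with
  | mem x hx =>
    obtain ⟨φ, rfl⟩ := hx
    exact ⟨dual_mem_polyFunctionAlgebra (Complex.reLm ∘ₗ φ.restrictScalars ℝ),
      dual_mem_polyFunctionAlgebra (Complex.imLm ∘ₗ φ.restrictScalars ℝ)⟩
  | algebraMap r => exact const r
  | add x y _ _ hx hy => exact hx.add hy
  | mul x y _ _ hx hy => exact hx.mul hy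

theorem isZariskiClosed {F : Set (W → ℂ)} (hF : ∀ f ∈ F, IsRealPolynomial f) :
    IsZariskiClosed ℝ {w | ∀ f ∈ F, f w = 0} := by
  refine ⟨(fun f w => (f w).re) '' F ∪ (fun f w => (f w).im) '' F, ?_, ?_⟩
  · rintro _ (⟨f, hf, rfl⟩ | ⟨f, hf, rfl⟩)
    · exact (hF f hf).1
    · exact (hF f hf).2
  · ext w
    constructor
    · rintro h _ (⟨f, hf, rfl⟩ | ⟨f, hf, rfl⟩)
      · exact congrArg Complex.re (h f hf)
      · exact congrArg Complex.im (h f hf)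
    · intro h f hf
      exact Complex.ext (h _ (Or.inl ⟨f, hf, rfl⟩)) (h _ (Or.inr ⟨f, hf, rfl⟩))

end IsRealPolynomial

theorem IsZariskiClosed.real_of_complex {Z : Set W} (hZ : IsZariskiClosed ℂ Z) :
    IsZariskiClosed ℝ Z := by
  obtain ⟨P, hP, rfl⟩ := hZ
  exact IsRealPolynomial.isZariskiClosed fun f hf => IsRealPolynomial.of_mem (hP hf)

end ZariskiClosed

/-! ### Algebraicity of isometry groups, stabilizers and determinant conditions -/

section Subgroups

variable {V : Type*} [AddCommGroup V] [Module ℂ V]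

theorem IsAlgebraicSubgroup.real_of_complex {N : Subgroup (V ≃ₗ[ℂ] V)}
    (hN : IsAlgebraicSubgroup ℂ N) : IsAlgebraicSubgroup ℝ N := by
  obtain ⟨Z, hZ, h⟩ := hN
  exact ⟨Z, hZ.real_of_complex, h⟩

theorem IsAlgebraicSubgroup.inf {k : Type*} [Field k] [Module k (Module.End ℂ V)]
    {N N' : Subgroup (V ≃ₗ[ℂ] V)} (hN : IsAlgebraicSubgroup k N) (hN' : IsAlgebraicSubgroup k N') :
    IsAlgebraicSubgroup k (N ⊓ N') := by
  obtain ⟨Z, hZ, h⟩ := hN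
  obtain ⟨Z', hZ', h'⟩ := hN'
  exact ⟨Z ∩ Z', hZ.inter hZ', fun g => and_congr (h g) (h' g)⟩

/-- `N` need not lie in `G`, so it is `G ⊓ N` that takes part in the infimum. -/
theorem algebraicHull_le {k : Type*} [Field k] [Module k (Module.End ℂ V)]
    {G N : Subgroup (V ≃ₗ[ℂ] V)} {T : Set (Module.End ℂ V)} (hG : IsAlgebraicSubgroup k G)
    (hTG : ∀ t ∈ T, ∃ g ∈ G, (g : V →ₗ[ℂ] V) = t) (hN : IsAlgebraicSubgroup k N)
    (hTN : ∀ g : V ≃ₗ[ℂ] V, (g : V →ₗ[ℂ] V) ∈ T → g ∈ N) : algebraicHull k G T ≤ N := by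
  have : G ⊓ N ∈ algebraicSubgroupsContaining k G T := by
    refine ⟨inf_le_left, hG.inf hN, fun t ht => ?_⟩
    obtain ⟨g, hg, rfl⟩ := hTG t ht
    exact ⟨g, ⟨hg, hTN g ht⟩, rfl⟩
  exact (sInf_le this).trans inf_le_right

theorem applyDual_mem_polyFunctionAlgebra (φ : Module.Dual ℂ V) (x : V) :
    (fun f : Module.End ℂ V => φ (f x)) ∈ polyFunctionAlgebra ℂ (Module.End ℂ V) :=
  dual_mem_polyFunctionAlgebra (φ ∘ₗ LinearMap.applyₗ (R := ℂ) x)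

theorem form_apply_eq_sum {σ : ℂ →+* ℂ} {ι : Type*} [Fintype ι] (b : Module.Basis ι ℂ V)
    (B : V →ₗ[ℂ] V →ₛₗ[σ] ℂ) (u w : V) :
    B u w = ∑ i, B.flip (b i) u * σ (b.coord i w) := by
  conv_lhs => rw [← b.sum_repr w, map_sum]
  refine Finset.sum_congr rfl fun i _ => ?_
  rw [LinearMap.map_smulₛₗ, smul_eq_mul, mul_comm]
  rfl

theorem isAlgebraicSubgroup_isometryGroup_bilinear [FiniteDimensional ℂ V]
    (B : V →ₗ[ℂ] V →ₗ[ℂ] ℂ) : IsAlgebraicSubgroup ℂ (isometryGroup B) := by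
  let b := Module.finBasis ℂ V
  refine ⟨_, ⟨Set.range fun (p : V × V) (f : Module.End ℂ V) =>
    B (f p.1) (f p.2) - B p.1 p.2, ?_, rfl⟩, fun g => ?_⟩
  · rintro _ ⟨p, rfl⟩
    refine Subalgebra.sub_mem _ ?_ (const_mem_polyFunctionAlgebra _)
    have : (fun f : Module.End ℂ V => B (f p.1) (f p.2)) =
        ∑ i, (fun f : Module.End ℂ V => B.flip (b i) (f p.1)) *
          (fun f : Module.End ℂ V => b.coord i (f p.2)) := by
      funext f
      rw [form_apply_eq_sum b, Finset.sum_apply]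
      rfl
    rw [this]
    exact Subalgebra.sum_mem _ fun i _ => Subalgebra.mul_mem _
      (applyDual_mem_polyFunctionAlgebra _ _) (applyDual_mem_polyFunctionAlgebra _ _)
  · constructor
    · rintro h _ ⟨p, rfl⟩
      exact sub_eq_zero.2 (h p.1 p.2)
    · exact fun h x y => sub_eq_zero.1 (h _ ⟨(x, y), rfl⟩)

theorem isAlgebraicSubgroup_isometryGroup_sesquilinear [FiniteDimensional ℂ V]
    (B : V →ₗ[ℂ] V →ₗ⋆[ℂ] ℂ) : IsAlgebraicSubgroup ℝ (isometryGroup B) := by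
  let b := Module.finBasis ℂ V
  refine ⟨_, IsRealPolynomial.isZariskiClosed
    (F := Set.range fun (p : V × V) (f : Module.End ℂ V) =>
      B (f p.1) (f p.2) + -B p.1 p.2) ?_, fun g => ?_⟩
  · rintro _ ⟨p, rfl⟩
    refine IsRealPolynomial.add ?_ (IsRealPolynomial.const _)
    simp only [form_apply_eq_sum b B]
    exact IsRealPolynomial.sum _ fun i => IsRealPolynomial.mul
      (.of_mem (applyDual_mem_polyFunctionAlgebra _ _))
      (IsRealPolynomial.star (.of_mem (applyDual_mem_polyFunctionAlgebra _ _)))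
  · constructor
    · rintro h _ ⟨p, rfl⟩
      exact (sub_eq_add_neg _ _).symm.trans (sub_eq_zero.2 (h p.1 p.2))
    · exact fun h x y => sub_eq_zero.1 ((sub_eq_add_neg _ _).trans (h _ ⟨(x, y), rfl⟩))

/-- The stabilizer of a subspace. -/
def subspaceStabilizer [FiniteDimensional ℂ V] (U : Submodule ℂ V) : Subgroup (V ≃ₗ[ℂ] V) where
  carrier := {g | ∀ u ∈ U, g u ∈ U}
  one_mem' := fun _ h => h
  mul_mem' := fun {_ _} ha hb u hu => ha _ (hb u hu)
  inv_mem' := fun {g} hg u hu => by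
    have h1 : U.map (g : V →ₗ[ℂ] V) ≤ U := Submodule.map_le_iff_le_comap.2 hg
    have h2 : U.map (g : V →ₗ[ℂ] V) = U :=
      Submodule.eq_of_le_of_finrank_eq h1 (LinearEquiv.finrank_map_eq g U)
    rw [← h2] at hu
    obtain ⟨v, hv, rfl⟩ := hu
    have : g⁻¹ (g v) = v := g.symm_apply_apply v
    exact (show g⁻¹ (g v) ∈ U from this.symm ▸ hv)

theorem isAlgebraicSubgroup_subspaceStabilizer [FiniteDimensional ℂ V] (U : Submodule ℂ V) :
    IsAlgebraicSubgroup ℂ (subspaceStabilizer U) := by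
  refine ⟨_, ⟨Set.range fun (p : U × U.dualAnnihilator) (f : Module.End ℂ V) =>
    p.2.1 (f p.1), ?_, rfl⟩, fun g => ?_⟩
  · rintro _ ⟨p, rfl⟩
    exact applyDual_mem_polyFunctionAlgebra _ _
  · constructor
    · rintro h _ ⟨p, rfl⟩
      exact (Submodule.mem_dualAnnihilator _).1 p.2.2 _ (h _ p.1.2)
    · intro h u hu
      refine (Subspace.forall_mem_dualAnnihilator_apply_eq_zero_iff U _).1 fun φ hφ => ?_
      exact h _ ⟨(⟨u, hu⟩, ⟨φ, hφ⟩), rfl⟩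

/-- The automorphisms whose determinant is an `n`-th root of unity. -/
noncomputable def detPowOneSubgroup (V : Type*) [AddCommGroup V] [Module ℂ V] (n : ℕ) :
    Subgroup (V ≃ₗ[ℂ] V) :=
  ((powMonoidHom n).comp (LinearEquiv.det : (V ≃ₗ[ℂ] V) →* ℂˣ)).ker

theorem mem_detPowOneSubgroup {n : ℕ} {g : V ≃ₗ[ℂ] V} :
    g ∈ detPowOneSubgroup V n ↔ LinearMap.det (g : V →ₗ[ℂ] V) ^ n = 1 := by
  change LinearEquiv.det g ^ n = 1 ↔ _
  rw [Units.ext_iff, Units.val_pow_eq_pow_val, LinearEquiv.coe_det, Units.val_one]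

/-- The Leibniz formula makes the condition polynomial. This group serves to show that a hull
generated by reflections of finite order contains no one-parameter group of scalars. -/
theorem isAlgebraicSubgroup_detPowOneSubgroup [FiniteDimensional ℂ V] (n : ℕ) :
    IsAlgebraicSubgroup ℂ (detPowOneSubgroup V n) := by
  let b := Module.finBasis ℂ V
  refine ⟨_, ⟨{fun f : Module.End ℂ V => LinearMap.det f ^ n - 1}, ?_, rfl⟩, fun g => ?_⟩
  · rintro _ rfl
    refine Subalgebra.sub_mem _ (Subalgebra.pow_mem _ ?_ n) (const_mem_polyFunctionAlgebra 1)
    have : (fun f : Module.End ℂ V => LinearMap.det f) =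
        ∑ s : Equiv.Perm (Fin (Module.finrank ℂ V)), (Equiv.Perm.sign s : ℤ) •
          ∏ i, fun f : Module.End ℂ V => b.coord (s i) (f (b i)) := by
      funext f
      rw [← LinearMap.det_toMatrix b, Matrix.det_apply, Finset.sum_apply]
      refine Finset.sum_congr rfl fun s _ => ?_
      rw [Pi.smul_apply, Finset.prod_apply]
      simp only [LinearMap.toMatrix_apply, Module.Basis.coord_apply]
      rfl
    change (fun f : Module.End ℂ V => LinearMap.det f) ∈ _
    rw [this]
    exact Subalgebra.sum_mem _ fun s _ => Subalgebra.zsmul_mem _ (Subalgebra.prod_mem _ fun i _ =>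
      applyDual_mem_polyFunctionAlgebra _ _) _
  · rw [mem_detPowOneSubgroup]
    constructor
    · rintro h _ rfl
      exact sub_eq_zero.2 h
    · exact fun h => sub_eq_zero.1 (h _ rfl)

end Subgroups

/-! ### Isometry groups are generated by rank one perturbations of the identity -/

section Forms

variable {V : Type*} [AddCommGroup V] [Module ℂ V] {σ : ℂ →+* ℂ} {B : V →ₗ[ℂ] V →ₛₗ[σ] ℂ}

theorem rankOnePerturbation_apply (B : V →ₗ[ℂ] V →ₛₗ[σ] ℂ) (c : ℂ) (δ x : V) :
    rankOnePerturbation B c δ x = x + (c * B x δ) • δ := rfl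

theorem form_apply_isometry {g : V ≃ₗ[ℂ] V} (hg : g ∈ isometryGroup B) (x y : V) :
    B (g x) (g y) = B x y := hg x y

theorem exists_mem_isometryGroup [FiniteDimensional ℂ V] (hn : B.Nondegenerate)
    {f : Module.End ℂ V} (hf : ∀ x y, B (f x) (f y) = B x y) :
    ∃ g ∈ isometryGroup B, (g : V →ₗ[ℂ] V) = f := by
  have hinj : Function.Injective f := by
    rw [injective_iff_map_eq_zero]
    intro x hx
    refine hn.1 x fun y => ?_
    rw [← hf, hx, map_zero, LinearMap.zero_apply]
  exact ⟨LinearEquiv.ofInjectiveEndo f hinj, hf, LinearMap.ext fun x => rfl⟩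

/-- When `B δ δ ≠ 0`, the condition on `c` says that the eigenvalue `a = 1 + c B(δ, δ)` of the map
on `δ` satisfies `a σ(a) = 1`. -/
theorem rankOnePerturbation_isometry (hB : ∀ x y, B x y = σ (B y x)) {c : ℂ} {δ : V}
    (hc : c + σ c + c * σ c * B δ δ = 0) (x y : V) :
    B (rankOnePerturbation B c δ x) (rankOnePerturbation B c δ y) = B x y := by
  simp only [rankOnePerturbation_apply, map_add, LinearMap.add_apply, map_smul,
    LinearMap.map_smulₛₗ, LinearMap.smul_apply, smul_eq_mul, map_mul]
  rw [← hB δ y]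
  linear_combination (B x δ * B δ y) * hc

theorem form_eq_zero_symm (hB : ∀ x y, B x y = σ (B y x)) {x y : V} (h : B x y = 0) :
    B y x = 0 := by
  rw [hB, h, map_zero]

/-- Polarization, uniform in `σ`: if `B u v ≠ 0`, rescale `u` so that `B u v = 1`; then `u + v` has
norm 2. -/
theorem form_eq_zero_of_isotropic (hB : ∀ x y, B x y = σ (B y x)) (D : Submodule ℂ V)
    (hD : ∀ v ∈ D, B v v = 0) {u v : V} (hu : u ∈ D) (hv : v ∈ D) : B u v = 0 := by
  by_contra h
  have h1 := hD ((B u v)⁻¹ • u + v) (D.add_mem (D.smul_mem _ hu) hv)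
  have h2 : B ((B u v)⁻¹ • u) v = 1 := by
    rw [map_smul, LinearMap.smul_apply, smul_eq_mul, inv_mul_cancel₀ h]
  rw [map_add, map_add, LinearMap.add_apply, LinearMap.add_apply, hD _ (D.smul_mem _ hu), h2,
    hD v hv, hB v, h2, map_one] at h1
  norm_num at h1

/-- If a vector moves to another one of the same norm along an anisotropic direction, some
isometry of rank one moves it there. -/
theorem exists_quasiReflection [FiniteDimensional ℂ V] (hB : ∀ x y, B x y = σ (B y x))
    (hn : B.Nondegenerate) {u v : V} (huv : B u u = B v v) (he : B (v - u) (v - u) ≠ 0) :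
    ∃ g ∈ isometryGroup B, ∃ c, (g : V →ₗ[ℂ] V) = rankOnePerturbation B c (v - u) ∧ g u = v := by
  -- With `z = B u (v - u)`, equality of norms gives `B (v - u) (v - u) = -(z + σ z)`, which is
  -- exactly what makes `c = z⁻¹` an isometry parameter; and this `c` sends `u` to `v`.
  have hee : B (v - u) (v - u) = -(B u (v - u) + σ (B u (v - u))) := by
    rw [← hB]
    simp only [map_sub, LinearMap.sub_apply]
    linear_combination -huv
  have hz : B u (v - u) ≠ 0 := by
    intro h
    rw [h, map_zero, add_zero, neg_zero] at hee
    exact he hee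
  have hz' : σ (B u (v - u)) ≠ 0 := (map_ne_zero σ).2 hz
  obtain ⟨g, hg, hgc⟩ := exists_mem_isometryGroup hn
    (rankOnePerturbation_isometry hB (c := (B u (v - u))⁻¹) (δ := v - u) (by
      rw [hee, map_inv₀]
      field_simp
      ring))
  refine ⟨g, hg, _, hgc, ?_⟩
  change (g : V →ₗ[ℂ] V) u = v
  rw [hgc, rankOnePerturbation_apply, inv_mul_cancel₀ hz, one_smul, add_sub_cancel]

/-- Cartan–Dieudonné induction on a nondegenerate `W` such that `g` preserves `W` and fixes its
orthogonal complement. Quasi-reflections along vectors of `W` bring `g v` back to an anisotropic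
`v`, and `W` shrinks to the orthogonal of `v` in `W`. -/
theorem isometryGroup_le_of_quasiReflection_mem [FiniteDimensional ℂ V]
    (hB : ∀ x y, B x y = σ (B y x)) (hn : B.Nondegenerate) {N : Subgroup (V ≃ₗ[ℂ] V)}
    (hN : ∀ g ∈ isometryGroup B, ∀ c w, B w w ≠ 0 →
      (g : V →ₗ[ℂ] V) = rankOnePerturbation B c w → g ∈ N) : isometryGroup B ≤ N := by
  have key : ∀ n : ℕ, ∀ W : Submodule ℂ V, Module.finrank ℂ W = n →
      (∀ w ∈ W, (∀ w' ∈ W, B w w' = 0) → w = 0) → ∀ g ∈ isometryGroup B,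
      (∀ w ∈ W, g w ∈ W) → (∀ x, (∀ w ∈ W, B x w = 0) → g x = x) → g ∈ N := by
    intro n
    induction n using Nat.strong_induction_on with
    | _ n ih =>
    intro W hWn hW g hg hgW hgx
    by_cases hiso : ∀ v ∈ W, B v v = 0
    · have hW0 : ∀ w ∈ W, w = 0 := fun w hw =>
        hW w hw fun w' hw' => form_eq_zero_of_isotropic hB W hiso hw hw'
      have : g = 1 := by
        ext x
        exact hgx x fun w hw => by rw [hW0 w hw, map_zero]
      rw [this]
      exact N.one_mem
    · push Not at hiso
      obtain ⟨v, hv, hvv⟩ := hiso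
      -- a product of quasi-reflections along vectors of `W` that moves `v` to `g v`
      have hmove : ∃ τ ∈ isometryGroup B, τ ∈ N ∧ τ ∈ subspaceStabilizer W ∧
          (∀ x, (∀ w ∈ W, B x w = 0) → τ x = x) ∧ τ v = g v := by
        have hstep : ∀ u u' : V, u ∈ W → u' ∈ W → B u u = B u' u' →
            B (u' - u) (u' - u) ≠ 0 → ∃ τ ∈ isometryGroup B, τ ∈ N ∧ τ ∈ subspaceStabilizer W ∧
            (∀ x, (∀ w ∈ W, B x w = 0) → τ x = x) ∧ τ u = u' := by
          intro u u' hu hu' huu he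
          obtain ⟨τ, hτ, c, hc, hτu⟩ := exists_quasiReflection hB hn huu he
          have happ : ∀ x, τ x = x + (c * B x (u' - u)) • (u' - u) := fun x =>
            LinearMap.congr_fun hc x
          have heW : u' - u ∈ W := W.sub_mem hu' hu
          refine ⟨τ, hτ, hN τ hτ c _ he hc, fun w hw => ?_, fun x hx => ?_, hτu⟩
          · rw [happ]
            exact W.add_mem hw (W.smul_mem _ heW)
          · rw [happ, hx _ heW, mul_zero, zero_smul, add_zero]
        -- The norms of `g v - v` and `g v + v` add up to `4 B(v, v) ≠ 0`. If the first is
        -- isotropic, go through `-v`.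
        by_cases he : B (g v - v) (g v - v) = 0
        · have he' : B (g v - -v) (g v - -v) ≠ 0 := by
            intro h
            have h4 : (4 : ℂ) * B v v = 0 := by
              have h1 := form_apply_isometry hg v v
              simp only [map_sub, map_neg, LinearMap.sub_apply, LinearMap.neg_apply] at he h
              linear_combination he + h - 2 * h1
            exact hvv ((mul_eq_zero.1 h4).resolve_left (by norm_num))
          obtain ⟨τ, h1, h2, h3, h4, h5⟩ := hstep (-v) (g v) (W.neg_mem hv) (hgW v hv)
            (by simp [form_apply_isometry hg]) he'
          obtain ⟨τ', h1', h2', h3', h4', h5'⟩ := hstep v (-v) hv (W.neg_mem hv) (by simp) (by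
            simp only [map_sub, map_neg, LinearMap.sub_apply, LinearMap.neg_apply]
            intro h
            have h4 : (4 : ℂ) * B v v = 0 := by linear_combination h
            exact hvv ((mul_eq_zero.1 h4).resolve_left (by norm_num)))
          refine ⟨τ * τ', mul_mem h1 h1', mul_mem h2 h2', mul_mem h3 h3', fun x hx => ?_, ?_⟩
          · rw [LinearEquiv.mul_apply, h4' x hx, h4 x hx]
          · rw [LinearEquiv.mul_apply, h5', h5]
        · exact hstep v (g v) hv (hgW v hv) (form_apply_isometry hg v v).symm he
      obtain ⟨τ, hτ, hτN, hτW, hτx, hτv⟩ := hmove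
      let W' : Submodule ℂ V := W ⊓ LinearMap.ker (B.flip v)
      have hW' : ∀ w, w ∈ W' ↔ w ∈ W ∧ B w v = 0 := fun w => Iff.rfl
      have hlt : W' < W := lt_of_le_of_ne inf_le_left fun h => hvv ((hW' v).1 (h ▸ hv)).2
      have hproj : ∀ x, B (x - (B x v / B v v) • v) v = 0 := fun x => by
        rw [map_sub, LinearMap.sub_apply, map_smul, LinearMap.smul_apply, smul_eq_mul,
          div_mul_cancel₀ _ hvv, sub_self]
      have hsplit : ∀ w ∈ W, ∃ w' ∈ W', ∃ a : ℂ, w = w' + a • v := fun w hw =>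
        ⟨w - (B w v / B v v) • v, ⟨W.sub_mem hw (W.smul_mem _ hv), hproj w⟩, _,
          (sub_add_cancel _ _).symm⟩
      have hτi : ∀ x, τ x = x → τ⁻¹ x = x := fun x hx => by
        conv_lhs => rw [← hx]
        exact τ.symm_apply_apply x
      have hg'v : (τ⁻¹ * g) v = v := by
        rw [LinearEquiv.mul_apply, ← hτv]
        exact τ.symm_apply_apply v
      have hg' : τ⁻¹ * g ∈ isometryGroup B := mul_mem (inv_mem hτ) hg
      have : τ⁻¹ * g ∈ N := by
        refine ih _ (hWn ▸ Submodule.finrank_lt_finrank_of_lt hlt) W' rfl ?_ _ hg' ?_ ?_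
        · intro w hw hw0
          refine hW w hw.1 fun y hy => ?_
          obtain ⟨w', hw', a, rfl⟩ := hsplit y hy
          rw [map_add, LinearMap.map_smulₛₗ, hw0 w' hw', ((hW' w).1 hw).2, smul_zero, add_zero]
        · intro w hw
          refine ⟨(inv_mem hτW) _ (hgW w hw.1), ?_⟩
          have := form_apply_isometry hg' w v
          rw [hg'v] at this
          exact this.trans ((hW' w).1 hw).2
        · intro x hx
          set y := x - (B x v / B v v) • v with hy
          have hyW : ∀ w ∈ W, B y w = 0 := by
            intro w hw
            obtain ⟨w', hw', a, rfl⟩ := hsplit w hw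
            rw [map_add, LinearMap.map_smulₛₗ, hproj x, smul_zero, add_zero, hy, map_sub,
              LinearMap.sub_apply, hx w' hw', map_smul, LinearMap.smul_apply,
              form_eq_zero_symm hB ((hW' w').1 hw').2, smul_zero, sub_zero]
          have hxy : x = y + (B x v / B v v) • v := (sub_add_cancel _ _).symm
          have hgy : (τ⁻¹ * g) y = y := by
            rw [LinearEquiv.mul_apply, hgx y hyW, hτi y (hτx y hyW)]
          rw [hxy, map_add, map_smul, hg'v, hgy]
      have := mul_mem hτN this
      rwa [mul_inv_cancel_left] at this
  intro g hg
  refine key _ ⊤ rfl (fun w _ h => hn.1 w fun y => h y trivial) g hg (fun _ _ => trivial)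
    fun x hx => ?_
  have hx0 : x = 0 := hn.1 x fun y => hx y trivial
  rw [hx0, map_zero]

theorem rankOnePerturbation_isometry_of_isAlt {Q : V →ₗ[ℂ] V →ₗ[ℂ] ℂ} (hQ : Q.IsAlt) (c : ℂ)
    (δ x y : V) :
    Q (rankOnePerturbation Q c δ x) (rankOnePerturbation Q c δ y) = Q x y := by
  have h1 : Q δ δ = 0 := hQ δ
  have h2 : Q δ y = -Q y δ := (hQ.neg y δ).symm
  simp only [rankOnePerturbation_apply, map_add, LinearMap.add_apply, map_smul,
    LinearMap.smul_apply, smul_eq_mul, h1, h2]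
  ring

/-- Induction on the codimension of the fixed space of `g`. If `Q x (g x) ≠ 0`, a transvection along
`g x - x` sends `x` to `g x` and fixes all that `g` fixes, so dividing by it enlarges the fixed
space. If there is no such `x`, one preliminary transvection creates one. -/
theorem isometryGroup_le_of_transvection_mem [FiniteDimensional ℂ V]
    {Q : V →ₗ[ℂ] V →ₗ[ℂ] ℂ} (hQ : Q.IsAlt) (hn : Q.Nondegenerate) {N : Subgroup (V ≃ₗ[ℂ] V)}
    (hN : ∀ g ∈ isometryGroup Q, ∀ c w,
      (g : V →ₗ[ℂ] V) = rankOnePerturbation Q c w → g ∈ N) : isometryGroup Q ≤ N := by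
  let F : (V ≃ₗ[ℂ] V) → Submodule ℂ V := fun g => LinearMap.ker ((g : V →ₗ[ℂ] V) - 1)
  have hF : ∀ g x, x ∈ F g ↔ g x = x := fun g x => by
    rw [LinearMap.mem_ker, LinearMap.sub_apply, sub_eq_zero]
    rfl
  have htrans : ∀ c w, ∃ τ ∈ isometryGroup Q, τ ∈ N ∧ ∀ x, τ x = x + (c * Q x w) • w := by
    intro c w
    obtain ⟨τ, hτ, h⟩ := exists_mem_isometryGroup hn (rankOnePerturbation_isometry_of_isAlt hQ c w)
    exact ⟨τ, hτ, hN τ hτ c w h, fun x => LinearMap.congr_fun h x⟩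
  have hfix : ∀ g ∈ isometryGroup Q, ∀ x f, g f = f → Q f (g x - x) = 0 := by
    intro g hg x f hf
    have := form_apply_isometry hg f x
    rw [hf] at this
    rw [map_sub, this, sub_self]
  have key : ∀ n : ℕ, ∀ g ∈ isometryGroup Q, Module.finrank ℂ V - Module.finrank ℂ (F g) = n →
      g ∈ N := by
    intro n
    induction n using Nat.strong_induction_on with
    | _ n ih =>
    have hstep : ∀ g ∈ isometryGroup Q, Module.finrank ℂ V - Module.finrank ℂ (F g) ≤ n →
        (∃ x, Q x (g x) ≠ 0) → g ∈ N := by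
      rintro g hg hgn ⟨x, hx⟩
      obtain ⟨τ, hτ, hτN, happ⟩ := htrans (Q x (g x))⁻¹ (g x - x)
      have hτx : τ x = g x := by
        rw [happ, map_sub, hQ x, sub_zero, inv_mul_cancel₀ hx, one_smul, add_sub_cancel]
      have hτf : ∀ f, g f = f → τ f = f := fun f hf => by
        rw [happ, hfix g hg x f hf, mul_zero, zero_smul, add_zero]
      have hle : F g ≤ F (τ⁻¹ * g) := by
        intro f hf
        rw [hF] at hf ⊢
        rw [LinearEquiv.mul_apply, hf]
        conv_lhs => rw [← hτf f hf]
        exact τ.symm_apply_apply f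
      have hxF : x ∈ F (τ⁻¹ * g) := by
        rw [hF, LinearEquiv.mul_apply, ← hτx]
        exact τ.symm_apply_apply x
      have hxg : x ∉ F g := by
        rw [hF]
        intro h
        rw [h] at hx
        exact hx (hQ x)
      have hlt := Submodule.finrank_lt_finrank_of_lt
        (lt_of_le_of_ne hle fun h => hxg (h ▸ hxF))
      have hle' := Submodule.finrank_le (F (τ⁻¹ * g))
      have := ih _ (by omega) (τ⁻¹ * g) (mul_mem (inv_mem hτ) hg) rfl
      have := mul_mem hτN this
      rwa [mul_inv_cancel_left] at this
    intro g hg hgn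
    by_cases hex : ∃ x, Q x (g x) ≠ 0
    · exact hstep g hg hgn.le hex
    push Not at hex
    by_cases h1 : g = 1
    · rw [h1]
      exact N.one_mem
    -- Polarizing `Q x (g x) = 0` makes `g` self-adjoint; being an isometry, it is an involution.
    have hsym : ∀ x y, Q x (g y) = Q (g x) y := by
      intro x y
      have h := hex (x + y)
      simp only [map_add, LinearMap.add_apply, hex, zero_add, add_zero] at h
      rw [← hQ.neg y (g x)]
      linear_combination h
    have hsq : ∀ x, g (g x) = x := by
      intro x
      refine sub_eq_zero.1 (hn.2 _ fun y => ?_)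
      rw [map_sub, hsym, form_apply_isometry hg, sub_self]
    obtain ⟨z, hz⟩ : ∃ z, g z ≠ z := by
      by_contra! h
      exact h1 (LinearEquiv.ext h)
    obtain ⟨x, hx⟩ : ∃ x, Q x (g z - z) ≠ 0 := by
      by_contra! h
      exact hz (sub_eq_zero.1 (hn.2 _ h))
    obtain ⟨τ, hτ, hτN, happ⟩ := htrans 1 (g z - z)
    have hle : F g ≤ F (τ * g) := by
      intro f hf
      rw [hF] at hf ⊢
      rw [LinearEquiv.mul_apply, hf, happ, hfix g hg z f hf, mul_zero, zero_smul, add_zero]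
    have hmem : τ * g ∈ N := by
      refine hstep _ (mul_mem hτ hg) ?_ ⟨x, ?_⟩
      · have := Submodule.finrank_mono hle
        omega
      · rw [LinearEquiv.mul_apply, happ, map_add, hex, zero_add, map_smul, smul_eq_mul, one_mul]
        refine mul_ne_zero ?_ hx
        rw [← hsym, map_sub, hsq, map_sub]
        rw [map_sub] at hx
        intro h
        exact hx (by linear_combination -h)
    have := mul_mem (inv_mem hτN) hmem
    rwa [inv_mul_cancel_left] at this
  exact fun g hg => key _ g hg rfl

/-- If `R` lies in the union of a proper nonzero subspace and its orthogonal complement, then this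
subspace is invariant under every group that lies in all the algebraic groups containing the
perturbations along vectors of `R`. -/
theorem splitsOrthogonally_of_subset [FiniteDimensional ℂ V] {k : Type*} [Field k]
    [Module k (Module.End ℂ V)]
    {M : Subgroup (V ≃ₗ[ℂ] V)} {R : Set V} {c : ℂ}
    (hM : ∀ N : Subgroup (V ≃ₗ[ℂ] V), IsAlgebraicSubgroup k N →
      (∀ g : V ≃ₗ[ℂ] V, (g : V →ₗ[ℂ] V) ∈ (fun δ => rankOnePerturbation B c δ) '' R → g ∈ N) →
      M ≤ N) {U : Submodule ℂ V} (hU : IsAlgebraicSubgroup k (subspaceStabilizer U))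
    (h0 : U ≠ ⊥) (h1 : U ≠ ⊤) (hR : R ⊆ (U : Set V) ∪ (U.orthogonalBilin B : Set V)) :
    SplitsOrthogonally B M R := by
  refine ⟨U, h0, h1, fun g hg u hu => ?_, hR⟩
  refine hM (subspaceStabilizer U) hU ?_ hg u hu
  rintro g ⟨δ, hδ, hgδ⟩ u hu
  have happ : g u = u + (c * B u δ) • δ := (LinearMap.congr_fun hgδ u).symm
  rw [happ]
  rcases hR hδ with h | h
  · exact U.add_mem hu (U.smul_mem _ h)
  · have : B u δ = 0 := (Submodule.mem_orthogonalBilin_iff.1 h) u hu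
    rw [this, mul_zero, zero_smul, add_zero]
    exact hu

/-- If some element of `R` outside `ℂ δ + D` is not orthogonal to `δ`, then `D` is isotropic, hence
orthogonal to all of `R` and so to `V`, which contradicts nondegeneracy. Otherwise every outside
element is orthogonal to both `δ` and `D`. -/
theorem subset_union_orthogonal (hB : ∀ x y, B x y = σ (B y x)) (hn : B.Nondegenerate)
    {R : Set V} (hspan : Submodule.span ℂ R = ⊤) {δ : V} {D : Submodule ℂ V} (hD0 : D ≠ ⊥)
    (hδ : ∀ v ∈ D, B δ v = 0)
    (horth : ∀ δ' ∈ R, δ' ∉ Submodule.span ℂ {δ} ⊔ D → ∀ v ∈ D, B δ' v = 0)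
    (hiso : ∀ δ' ∈ R, δ' ∉ Submodule.span ℂ {δ} ⊔ D → B δ' δ ≠ 0 → ∀ v ∈ D, B v v = 0) :
    R ⊆ ((Submodule.span ℂ {δ} ⊔ D : Submodule ℂ V) : Set V) ∪
      ((Submodule.span ℂ {δ} ⊔ D).orthogonalBilin B : Set V) := by
  have hmem : ∀ x ∈ Submodule.span ℂ {δ} ⊔ D, ∃ a : ℂ, ∃ d ∈ D, x = a • δ + d := by
    intro x hx
    obtain ⟨y, hy, d, hd, rfl⟩ := Submodule.mem_sup.1 hx
    obtain ⟨a, rfl⟩ := Submodule.mem_span_singleton.1 hy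
    exact ⟨a, d, hd, rfl⟩
  by_cases hbad : ∃ δ' ∈ R, δ' ∉ Submodule.span ℂ {δ} ⊔ D ∧ B δ' δ ≠ 0
  · exfalso
    obtain ⟨δ', hδ', hnot, hne⟩ := hbad
    have hDiso := hiso δ' hδ' hnot hne
    apply hD0
    rw [Submodule.eq_bot_iff]
    intro v hv
    refine hn.2 v fun x => ?_
    have : Submodule.span ℂ R ≤ LinearMap.ker (B.flip v) := by
      refine Submodule.span_le.2 fun r hr => ?_
      change B r v = 0
      by_cases hrU : r ∈ Submodule.span ℂ {δ} ⊔ D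
      · obtain ⟨a, d, hd, rfl⟩ := hmem r hrU
        rw [map_add, LinearMap.add_apply, map_smul, LinearMap.smul_apply, hδ v hv, smul_zero,
          zero_add, form_eq_zero_of_isotropic hB D hDiso hd hv]
      · exact horth r hr hrU v hv
    exact this (hspan ▸ Submodule.mem_top : x ∈ Submodule.span ℂ R)
  · push Not at hbad
    intro r hr
    by_cases hrU : r ∈ Submodule.span ℂ {δ} ⊔ D
    · exact Or.inl hrU
    · refine Or.inr (Submodule.mem_orthogonalBilin_iff.2 fun x hx => ?_)
      obtain ⟨a, d, hd, rfl⟩ := hmem x hx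
      change B (a • δ + d) r = 0
      rw [map_add, LinearMap.add_apply, map_smul, LinearMap.smul_apply,
        form_eq_zero_symm hB (hbad r hr hrU), smul_zero, zero_add,
        form_eq_zero_symm hB (horth r hr hrU d hd)]

end Forms

/-! ### Lie algebras of groups of isometries -/

section LieIsometry

variable {V : Type*} [AddCommGroup V] [Module ℂ V] {σ : ℂ →+* ℂ} {B : V →ₗ[ℂ] V →ₛₗ[σ] ℂ}

/-- The endomorphism `x ↦ B(x, a) b`. -/
def formTensor (B : V →ₗ[ℂ] V →ₛₗ[σ] ℂ) (a b : V) : Module.End ℂ V :=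
  (B.flip a).smulRight b

theorem formTensor_apply (a b x : V) : formTensor B a b x = B x a • b := rfl

/-- The endomorphism `x ↦ B(x, a) b - B(x, b) a`. -/
def formWedge (B : V →ₗ[ℂ] V →ₛₗ[σ] ℂ) (a b : V) : Module.End ℂ V :=
  formTensor B a b - formTensor B b a

theorem formWedge_apply (a b x : V) : formWedge B a b x = B x a • b - B x b • a := rfl

theorem formWedge_add (a b c : V) :
    formWedge B a (b + c) = formWedge B a b + formWedge B a c := by
  ext x
  simp only [formWedge_apply, LinearMap.add_apply, map_add]
  module

namespace IsLieAlgebraOf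

variable {M : Subgroup (V ≃ₗ[ℂ] V)} {L : Submodule ℝ (Module.End ℂ V)}

theorem smul_mem (hL : IsLieAlgebraOf M L) (hM : IsAlgebraicSubgroup ℂ M) (z : ℂ)
    {X : Module.End ℂ V} (hX : X ∈ L) : z • X ∈ L := by
  have h : z • X = z.re • X + z.im • (Complex.I • X) := by
    conv_lhs => rw [← Complex.re_add_im z, add_smul, mul_smul]
    rfl
  rw [h]
  exact L.add_mem (L.smul_mem _ hX) (L.smul_mem _ (hL.I_smul_mem hM X hX))

/-- This is the derivative of `B (g x) y = B x (g⁻¹ y)`; `hσ` is what makes both sides real linear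
in the endomorphism. -/
theorem skew (hL : IsLieAlgebraOf M L) (hσ : ∀ r : ℝ, σ r = r) (hM : M ≤ isometryGroup B)
    {X : Module.End ℂ V} (hX : X ∈ L) (x y : V) : B (X x) y = -B x (X y) := by
  let φ : Module.End ℂ V →ₗ[ℝ] ℂ :=
    { toFun := fun f => B (f x) y
      map_add' := fun f g => by simp
      map_smul' := fun r f => by
        change B ((r : ℂ) • f x) y = (r : ℂ) * B (f x) y
        rw [map_smul, LinearMap.smul_apply, smul_eq_mul] }
  let ψ : Module.End ℂ V →ₗ[ℝ] ℂ :=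
    { toFun := fun f => B x (f y)
      map_add' := fun f g => by simp
      map_smul' := fun r f => by
        change B x ((r : ℂ) • f y) = (r : ℂ) * B x (f y)
        rw [LinearMap.map_smulₛₗ, hσ, smul_eq_mul] }
  refine hL.deriv_eq φ ψ (fun g hg => ?_) X hX
  have h := form_apply_isometry (hM hg) x (g⁻¹ y)
  have e : g (g⁻¹ y) = y := g.apply_symm_apply y
  rw [e] at h
  exact h

theorem mem_of_exp_sq_zero (hL : IsLieAlgebraOf M L) {X : Module.End ℂ V} (hX : X ∈ L)
    (h0 : ∀ x, X (X x) = 0) {g : V ≃ₗ[ℂ] V} (hg : ∀ x, g x = x + X x) : g ∈ M := by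
  obtain ⟨m, hm, -, hmx⟩ := hL.exists_exp X hX
  have : g = m := LinearEquiv.ext fun x => by rw [hg, hmx x (h0 x)]
  rwa [this]

end IsLieAlgebraOf

/-- The component of `x` orthogonal to `δ`. -/
noncomputable def orthComponent (B : V →ₗ[ℂ] V →ₛₗ[σ] ℂ) (δ x : V) : V := x - (B x δ / B δ δ) • δ

theorem orthComponent_of_orth {δ x : V} (h : B x δ = 0) : orthComponent B δ x = x := by
  rw [orthComponent, h, zero_div, zero_smul, sub_zero]

/-- The vectors `v` orthogonal to `δ` such that `L` contains the rotations of the complex line of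
`v` into that of `δ`. -/
def rotationSpace (B : V →ₗ[ℂ] V →ₛₗ[σ] ℂ) (L : Submodule ℝ (Module.End ℂ V)) (δ : V) :
    Submodule ℂ V where
  carrier := {v | B δ v = 0 ∧ ∀ z : ℂ, formWedge B δ (z • v) ∈ L}
  zero_mem' := ⟨map_zero _, fun z => by
    have : formWedge B δ (z • 0) = 0 := by ext x; simp [formWedge_apply]
    rw [this]
    exact L.zero_mem⟩
  add_mem' := fun {u v} hu hv => ⟨by rw [map_add, hu.1, hv.1, add_zero], fun z => by
    rw [smul_add, formWedge_add]
    exact L.add_mem (hu.2 z) (hv.2 z)⟩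
  smul_mem' := fun a v hv => ⟨by rw [LinearMap.map_smulₛₗ, hv.1, smul_zero], fun z => by
    rw [smul_smul]
    exact hv.2 _⟩

theorem formWedge_mem_of_mem_rotationSpace {L : Submodule ℝ (Module.End ℂ V)} {δ v : V}
    (hv : v ∈ rotationSpace B L δ) : formWedge B δ v ∈ L := by
  simpa using hv.2 1

theorem mem_span_sup_of_orthComponent_mem {δ x : V} {D : Submodule ℂ V}
    (h : orthComponent B δ x ∈ D) : x ∈ Submodule.span ℂ {δ} ⊔ D := by
  have : x = (B x δ / B δ δ) • δ + orthComponent B δ x := by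
    rw [orthComponent, add_sub_cancel]
  rw [this]
  exact Submodule.add_mem_sup (Submodule.smul_mem _ _ (Submodule.mem_span_singleton_self δ)) h

/-! ### How rotation spaces at different elements of `R` interact -/

section RotationSpace

variable {L : Submodule ℝ (Module.End ℂ V)} {R : Set V}

/-- The rotation of `δ` into `v` sends `δ'` to a combination `w` of `δ` and `v`. After rescaling
`v`, `w` is orthogonal to `δ'`, so it is a rotation direction at `δ'`. Rotating `δ'` into `w` and
applying the result to `δ` gives a nonzero multiple of `δ'` modulo `w`. -/
theorem mem_span_sup_rotationSpace_of_ne_zero (hB : ∀ x y, B x y = σ (B y x))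
    (hσσ : ∀ z, σ (σ z) = z)
    (hcomp : ∀ X ∈ L, ∀ δ ∈ R, orthComponent B δ (X δ) ∈ rotationSpace B L δ)
    (hR : ∀ δ ∈ R, B δ δ ≠ 0) {δ δ' v : V} (hδ : δ ∈ R) (hδ' : δ' ∈ R)
    (hv : v ∈ rotationSpace B L δ) (hne : B δ' v ≠ 0) :
    δ' ∈ Submodule.span ℂ {δ} ⊔ rotationSpace B L δ := by
  -- rescale `v`
  obtain ⟨v, hv, hne, horth⟩ : ∃ v ∈ rotationSpace B L δ, B δ' v ≠ 0 ∧
      B δ' δ * B v δ' - B δ' v * B δ δ' = 0 := by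
    by_cases hp : B δ' δ = 0
    · exact ⟨v, hv, hne, by rw [hp, form_eq_zero_symm hB hp, zero_mul, mul_zero, sub_zero]⟩
    · have h1 : B δ' (σ (B δ' δ / B δ' v) • v) = B δ' δ := by
        rw [LinearMap.map_smulₛₗ, hσσ, smul_eq_mul, div_mul_cancel₀ _ hne]
      refine ⟨_, Submodule.smul_mem _ _ hv, h1.symm ▸ hp, ?_⟩
      rw [hB _ δ', h1, hB δ δ', sub_self]
  set w := B δ' δ • v - B δ' v • δ with hw
  have hwδ' : B w δ' = 0 := by
    rw [hw, map_sub, LinearMap.sub_apply, map_smul, map_smul, LinearMap.smul_apply,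
      LinearMap.smul_apply, smul_eq_mul, smul_eq_mul, horth]
  have hwmem : w ∈ rotationSpace B L δ' := by
    have h1 := hcomp _ (formWedge_mem_of_mem_rotationSpace hv) δ' hδ'
    rw [formWedge_apply, ← hw, orthComponent_of_orth hwδ'] at h1
    exact h1
  have h2 := mem_span_sup_of_orthComponent_mem
    (hcomp _ (formWedge_mem_of_mem_rotationSpace hwmem) δ hδ)
  rw [formWedge_apply] at h2
  have hδU : δ ∈ Submodule.span ℂ {δ} ⊔ rotationSpace B L δ :=
    Submodule.mem_sup_left (Submodule.mem_span_singleton_self δ)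
  have hvU : v ∈ Submodule.span ℂ {δ} ⊔ rotationSpace B L δ := Submodule.mem_sup_right hv
  have hwU : w ∈ Submodule.span ℂ {δ} ⊔ rotationSpace B L δ :=
    Submodule.sub_mem _ (Submodule.smul_mem _ _ hvU) (Submodule.smul_mem _ _ hδU)
  have hδw : B δ w = -(σ (B δ' v) * B δ δ) := by
    rw [hw, map_sub, LinearMap.map_smulₛₗ, LinearMap.map_smulₛₗ, hv.1, smul_zero, zero_sub,
      smul_eq_mul]
  have h3 := (Submodule.sub_mem_iff_right _ (Submodule.smul_mem _ (B δ δ') hwU)).1 h2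
  refine (Submodule.smul_mem_iff _ ?_).1 h3
  rw [hδw]
  exact neg_ne_zero.2 (mul_ne_zero ((map_ne_zero σ).2 hne) (hR δ hδ))

/-- As `δ'` is orthogonal to `v` but not to `δ`, `v` is also a rotation direction at `δ'`. The
bracket of the two rotations sends `δ` to `B(δ, δ) B(v, v) δ'` modulo `δ`; a nonzero coefficient
would put `δ'` in the excluded subspace. -/
theorem isotropic_rotationSpace_of_notMem (hB : ∀ x y, B x y = σ (B y x))
    (hcomp : ∀ X ∈ L, ∀ δ ∈ R, orthComponent B δ (X δ) ∈ rotationSpace B L δ)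
    (hbr : ∀ X ∈ L, ∀ Y ∈ L, X * Y - Y * X ∈ L)
    (hR : ∀ δ ∈ R, B δ δ ≠ 0) {δ δ' v : V} (hδ : δ ∈ R) (hδ' : δ' ∈ R)
    (hv : v ∈ rotationSpace B L δ) (hδ'v : B δ' v = 0) (hne : B δ' δ ≠ 0)
    (hnot : δ' ∉ Submodule.span ℂ {δ} ⊔ rotationSpace B L δ) : B v v = 0 := by
  by_contra hvv
  have hvδ' : B v δ' = 0 := form_eq_zero_symm hB hδ'v
  have hvδ : B v δ = 0 := form_eq_zero_symm hB hv.1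
  have hv' : v ∈ rotationSpace B L δ' := by
    have h1 := hcomp _ (formWedge_mem_of_mem_rotationSpace hv) δ' hδ'
    rw [formWedge_apply, hδ'v, zero_smul, sub_zero, orthComponent_of_orth (by
      rw [map_smul, LinearMap.smul_apply, hvδ', smul_zero])] at h1
    exact (Submodule.smul_mem_iff _ hne).1 h1
  have h2 := mem_span_sup_of_orthComponent_mem (hcomp _ (hbr _
    (formWedge_mem_of_mem_rotationSpace hv) _ (formWedge_mem_of_mem_rotationSpace hv')) δ hδ)
  have hδU : δ ∈ Submodule.span ℂ {δ} ⊔ rotationSpace B L δ :=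
    Submodule.mem_sup_left (Submodule.mem_span_singleton_self δ)
  have h3 : (formWedge B δ v * formWedge B δ' v - formWedge B δ' v * formWedge B δ v) δ =
      (B δ δ * B v v) • δ' - (B δ δ' * B v v) • δ := by
    simp only [LinearMap.sub_apply, Module.End.mul_apply, formWedge_apply, map_smul, hv.1, hvδ, hvδ', zero_smul, sub_zero, zero_sub,
      smul_neg, smul_smul]
    module
  rw [h3] at h2
  have h4 := (Submodule.sub_mem_iff_left _ (Submodule.smul_mem _ (B δ δ' * B v v) hδU)).1 h2
  exact hnot ((Submodule.smul_mem_iff _ (mul_ne_zero (hR δ hδ) hvv)).1 h4)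

/-- If `R` is not contained in the union of a proper nonzero subspace and of its orthogonal
complement, one nonzero rotation space exhausts the orthogonal complement. -/
theorem mem_rotationSpace_of_orth (hB : ∀ x y, B x y = σ (B y x)) (hn : B.Nondegenerate)
    (hσσ : ∀ z, σ (σ z) = z) (hspan : Submodule.span ℂ R = ⊤)
    (hcomp : ∀ X ∈ L, ∀ δ ∈ R, orthComponent B δ (X δ) ∈ rotationSpace B L δ)
    (hbr : ∀ X ∈ L, ∀ Y ∈ L, X * Y - Y * X ∈ L)
    (hR : ∀ δ ∈ R, B δ δ ≠ 0)
    (hsplit : ∀ U : Submodule ℂ V, U ≠ ⊥ →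
      R ⊆ (U : Set V) ∪ (U.orthogonalBilin B : Set V) → U = ⊤)
    {δ : V} (hδ : δ ∈ R) (hD : rotationSpace B L δ ≠ ⊥) {v : V} (hv : B δ v = 0) :
    v ∈ rotationSpace B L δ := by
  have htop := hsplit (Submodule.span ℂ {δ} ⊔ rotationSpace B L δ)
    (fun h => hD (le_bot_iff.1 (h ▸ le_sup_right)))
    (subset_union_orthogonal hB hn hspan hD (fun v hv => hv.1)
      (fun δ' hδ' hnot v hv => by
        by_contra hne
        exact hnot (mem_span_sup_rotationSpace_of_ne_zero hB hσσ hcomp hR hδ hδ' hv hne))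
      (fun δ' hδ' hnot hne v hv => isotropic_rotationSpace_of_notMem hB hcomp hbr hR hδ hδ' hv
        (by
          by_contra hne
          exact hnot (mem_span_sup_rotationSpace_of_ne_zero hB hσσ hcomp hR hδ hδ' hv hne))
        hne hnot))
  obtain ⟨y, hy, d, hd, hyd⟩ := Submodule.mem_sup.1 (htop ▸ Submodule.mem_top : v ∈ _)
  obtain ⟨a, rfl⟩ := Submodule.mem_span_singleton.1 hy
  rw [← hyd, map_add, LinearMap.map_smulₛₗ, hd.1, add_zero, smul_eq_mul, mul_eq_zero,
    map_eq_zero] at hv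
  rw [← hyd, hv.resolve_right (hR δ hδ), zero_smul, zero_add]
  exact hd

end RotationSpace

/-- Conjugation of a skew endomorphism by a rank one perturbation of the identity. -/
theorem conj_rankOnePerturbation {X : Module.End ℂ V} (hX : ∀ x y, B (X x) y = -B x (X y))
    (c c' : ℂ) (δ : V) :
    rankOnePerturbation B c δ * X * rankOnePerturbation B c' δ =
      X + c' • formTensor B δ (X δ) - c • formTensor B (X δ) δ +
        (c * c' * B (X δ) δ) • formTensor B δ δ := by
  ext x
  simp only [Module.End.mul_apply, rankOnePerturbation_apply, LinearMap.add_apply,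
    LinearMap.sub_apply, LinearMap.smul_apply, formTensor_apply, map_add, map_smul, hX x δ]
  module

/-- The inverse of an isometry is its adjoint, and taking adjoints replaces `c` by `σ c`. -/
theorem coe_inv_eq_rankOnePerturbation (hB : ∀ x y, B x y = σ (B y x)) (hn : B.Nondegenerate)
    {s : V ≃ₗ[ℂ] V} (hs : s ∈ isometryGroup B) {c : ℂ} {δ : V}
    (h : (s : V →ₗ[ℂ] V) = rankOnePerturbation B c δ) :
    ((s⁻¹ : V ≃ₗ[ℂ] V) : V →ₗ[ℂ] V) = rankOnePerturbation B (σ c) δ := by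
  ext x
  refine sub_eq_zero.1 (hn.1 _ fun y => ?_)
  have h1 : B (s⁻¹ x) y = B x (s y) := by
    have := form_apply_isometry hs (s⁻¹ x) y
    have e : s (s⁻¹ x) = x := s.apply_symm_apply x
    rw [e] at this
    exact this.symm
  have h2 : s y = y + (c * B y δ) • δ := LinearMap.congr_fun h y
  rw [map_sub, LinearMap.sub_apply, sub_eq_zero]
  refine h1.trans ?_
  rw [h2, rankOnePerturbation_apply, map_add, map_add, LinearMap.add_apply,
    LinearMap.map_smulₛₗ, map_mul, ← hB δ y, map_smul, LinearMap.smul_apply, smul_eq_mul,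
    smul_eq_mul]
  ring

end LieIsometry

/-! ### Transvections -/

section Symplectic

variable {V : Type*} [AddCommGroup V] [Module ℂ V] {Q : V →ₗ[ℂ] V →ₗ[ℂ] ℂ}

/-- The powers of the transvection are `1 + n (δ ⊗ δ)`; Zariski closedness extends this from natural
`n` to the whole line. -/
theorem formTensor_self_mem [FiniteDimensional ℂ V] (hQ : Q.IsAlt) (hn : Q.Nondegenerate) {M : Subgroup (V ≃ₗ[ℂ] V)}
    {L : Submodule ℝ (Module.End ℂ V)} (hL : IsLieAlgebraOf M L) (hM : IsAlgebraicSubgroup ℂ M)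
    {δ : V} (hδ : ∃ g ∈ M, (g : V →ₗ[ℂ] V) = rankOnePerturbation Q 1 δ) :
    formTensor Q δ δ ∈ L := by
  obtain ⟨Z, hZ, hMZ⟩ := hM
  choose τ hτ hτc using fun c : ℂ =>
    exists_mem_isometryGroup hn (rankOnePerturbation_isometry_of_isAlt hQ c δ)
  have happ : ∀ c x, τ c x = x + (c * Q x δ) • δ := fun c x => LinearMap.congr_fun (hτc c) x
  have hadd : ∀ c c', τ (c + c') = τ c * τ c' := by
    intro c c'
    ext x
    have h0 : Q δ δ = 0 := hQ δ
    rw [LinearEquiv.mul_apply, happ, happ c', happ c]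
    simp only [map_add, LinearMap.add_apply, map_smul, LinearMap.smul_apply, h0, smul_zero,
      add_zero]
    module
  have h1 : τ 1 ∈ M := by
    obtain ⟨g, hg, hgc⟩ := hδ
    rwa [← LinearEquiv.toLinearMap_injective (hgc.trans (hτc 1).symm)]
  have hnat : ∀ n : ℕ, τ n ∈ M := by
    intro n
    induction n with
    | zero =>
      have : τ ((0 : ℕ) : ℂ) = 1 := by
        ext x
        rw [happ, Nat.cast_zero, zero_mul, zero_smul, add_zero]
        rfl
      rw [this]
      exact M.one_mem
    | succ n ih =>
      rw [Nat.cast_succ, hadd]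
      exact M.mul_mem ih h1
  have hline : ∀ c : ℂ, (τ c : V →ₗ[ℂ] V) = 1 + c • formTensor Q δ δ := by
    intro c
    ext x
    change τ c x = x + c • (Q x δ • δ)
    rw [happ, smul_smul]
  refine hL.mem_of_line _ fun t => ⟨τ (t : ℂ), (hMZ _).2 ?_, hline t⟩
  rw [hline]
  refine hZ.line_mem (fun n => ?_) (t : ℂ)
  rw [← hline]
  exact (hMZ _).1 (hnat n)

/-- The endomorphism `x ↦ Q(x, a) b + Q(x, b) a`. -/
def formSymm (Q : V →ₗ[ℂ] V →ₗ[ℂ] ℂ) (a b : V) : Module.End ℂ V :=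
  formTensor Q a b + formTensor Q b a

theorem formSymm_apply (a b x : V) : formSymm Q a b x = Q x a • b + Q x b • a := rfl

theorem exists_subspace_maximal_formSymm [FiniteDimensional ℂ V] (L : Submodule ℝ (Module.End ℂ V)) :
    ∃ U : Submodule ℂ V, (∀ u ∈ U, ∀ u' ∈ U, formSymm Q u u' ∈ L) ∧
      ∀ U' : Submodule ℂ V, (∀ u ∈ U', ∀ u' ∈ U', formSymm Q u u' ∈ L) → ¬ U < U' := by
  obtain ⟨U, hU, hmax⟩ := set_has_maximal_iff_noetherian.2
    (inferInstance : IsNoetherian ℂ V)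
    {U : Submodule ℂ V | ∀ u ∈ U, ∀ u' ∈ U, formSymm Q u u' ∈ L} ⟨⊥, by
      intro u hu u' hu'
      rw [Submodule.mem_bot] at hu hu'
      have : formSymm Q u u' = 0 := by
        ext x
        simp [formSymm_apply, hu, hu']
      rw [this]
      exact L.zero_mem⟩
  exact ⟨U, hU, hmax⟩

theorem symplectic_dichotomy [FiniteDimensional ℂ V] {R : Set V} {M : Subgroup (V ≃ₗ[ℂ] V)} (hQ : Q.IsAlt)
    (hn : Q.Nondegenerate) (hspan : Submodule.span ℂ R = ⊤)
    (hM : M = algebraicHull ℂ (isometryGroup Q) ((fun δ => rankOnePerturbation Q 1 δ) '' R)) :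
    SplitsOrthogonally Q M R ∨ M = isometryGroup Q := by
  have hG := isAlgebraicSubgroup_isometryGroup_bilinear Q
  have hT : ∀ t ∈ (fun δ => rankOnePerturbation Q 1 δ) '' R,
      ∃ g ∈ isometryGroup Q, (g : V →ₗ[ℂ] V) = t := by
    rintro _ ⟨δ, -, rfl⟩
    exact exists_mem_isometryGroup hn (rankOnePerturbation_isometry_of_isAlt hQ 1 δ)
  have hleast := isLeast_algebraicHull ℂ _ _ hG hT
  rw [← hM] at hleast
  obtain ⟨⟨hMG, hMalg, hMT⟩, -⟩ := hleast
  obtain ⟨L, hL⟩ := exists_isLieAlgebraOf hMalg.real_of_complex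
  have hskew : ∀ X ∈ L, ∀ x y, Q (X x) y = -Q x (X y) := fun X hX x y =>
    hL.skew (fun _ => rfl) hMG hX x y
  have hδL : ∀ δ ∈ R, formTensor Q δ δ ∈ L := fun δ hδ =>
    formTensor_self_mem hQ hn hL hMalg (hMT _ ⟨δ, hδ, rfl⟩)
  obtain ⟨U, hU, hmax⟩ := exists_subspace_maximal_formSymm (Q := Q) L
  have hself : ∀ w, formSymm Q w w = (2 : ℂ) • formTensor Q w w := fun w => by
    rw [formSymm, two_smul]
  -- the maximal subspace absorbs every vector of `R` that is not orthogonal to it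
  have habsorb : ∀ δ ∈ R, δ ∈ U ∨ ∀ u ∈ U, Q u δ = 0 := by
    intro δ hδ
    by_contra! hcon
    obtain ⟨hδU, u₀, hu₀, hne'⟩ := hcon
    have hne : Q δ u₀ ≠ 0 := by
      rw [← hQ.neg u₀ δ]
      exact neg_ne_zero.2 hne'
    have hbr : ∀ u ∈ U, ∀ u' ∈ U, formSymm Q δ (formSymm Q u u' δ) ∈ L := by
      intro u hu u' hu'
      -- For skew `X`, the bracket of `X` with `δ ⊗ δ` is the symmetric product of `δ` and `X δ`.
      have h1 := hL.bracket_mem _ (hU u hu u' hu') _ (hδL δ hδ)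
      have h2 : formSymm Q u u' * formTensor Q δ δ - formTensor Q δ δ * formSymm Q u u' =
          formSymm Q δ (formSymm Q u u' δ) := by
        ext x
        have h3 := hskew _ (hU u hu u' hu') x δ
        rw [LinearMap.sub_apply, Module.End.mul_apply, Module.End.mul_apply, formTensor_apply,
          formTensor_apply, h3, formSymm_apply δ, map_smul]
        module
      rwa [h2] at h1
    have hlin : ∀ (a b : ℂ) (u v : V), formSymm Q δ (a • u + b • v) =
        a • formSymm Q δ u + b • formSymm Q δ v := by
      intro a b u v
      ext x
      simp only [formSymm_apply, map_add, map_smul, LinearMap.add_apply, LinearMap.smul_apply,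
        smul_eq_mul]
      module
    -- First `u = u' = u₀`, where `X δ = 2 Q(δ, u₀) u₀`; this isolates `δ u₀`, which is then
    -- subtracted off to obtain `δ u` for every `u` in `U`.
    have h0 : formSymm Q δ u₀ ∈ L := by
      have h1 := hbr u₀ hu₀ u₀ hu₀
      rw [formSymm_apply u₀, hlin, ← add_smul] at h1
      have h2 := hL.smul_mem hMalg (Q δ u₀ + Q δ u₀)⁻¹ h1
      rwa [smul_smul, inv_mul_cancel₀ (by rw [← two_mul]; exact mul_ne_zero two_ne_zero hne),
        one_smul] at h2
    have hall : ∀ u ∈ U, formSymm Q δ u ∈ L := by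
      intro u hu
      have h1 := hbr u hu u₀ hu₀
      rw [formSymm_apply u, hlin] at h1
      have h2 := L.sub_mem h1 (hL.smul_mem hMalg (Q δ u) h0)
      rw [add_sub_cancel_left] at h2
      have h3 := hL.smul_mem hMalg (Q δ u₀)⁻¹ h2
      rwa [smul_smul, inv_mul_cancel₀ hne, one_smul] at h3
    refine hmax (U ⊔ Submodule.span ℂ {δ}) ?_ (lt_of_le_of_ne le_sup_left fun h => hδU ?_)
    · intro x hx y hy
      obtain ⟨u, hu, d, hd, rfl⟩ := Submodule.mem_sup.1 hx
      obtain ⟨u', hu', d', hd', rfl⟩ := Submodule.mem_sup.1 hy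
      obtain ⟨a, rfl⟩ := Submodule.mem_span_singleton.1 hd
      obtain ⟨a', rfl⟩ := Submodule.mem_span_singleton.1 hd'
      have h1 : formSymm Q (u + a • δ) (u' + a' • δ) = formSymm Q u u' + a' • formSymm Q δ u +
          a • formSymm Q δ u' + (2 * a * a') • formTensor Q δ δ := by
        ext x
        simp only [formSymm_apply, formTensor_apply, map_add, map_smul, LinearMap.add_apply,
          LinearMap.smul_apply, smul_eq_mul]
        module
      rw [h1]
      exact L.add_mem (L.add_mem (L.add_mem (hU u hu u' hu') (hL.smul_mem hMalg _ (hall u hu)))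
        (hL.smul_mem hMalg _ (hall u' hu'))) (hL.smul_mem hMalg _ (hδL δ hδ))
    · rw [h]
      exact Submodule.mem_sup_right (Submodule.mem_span_singleton_self δ)
  by_cases hUtop : U = ⊤
  · right
    refine le_antisymm hMG (isometryGroup_le_of_transvection_mem hQ hn fun g _ c w hgc => ?_)
    have hX : c • formTensor Q w w ∈ L := by
      have h1 := hU w (hUtop ▸ Submodule.mem_top) w (hUtop ▸ Submodule.mem_top)
      rw [hself] at h1
      have h2 := hL.smul_mem hMalg (c * 2⁻¹) h1
      rwa [smul_smul, mul_assoc, inv_mul_cancel₀ two_ne_zero, mul_one] at h2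
    -- `w ⊗ w` squares to zero because `Q` is alternating, so its exponential is the transvection
    -- itself.
    refine hL.mem_of_exp_sq_zero hX (fun x => ?_) fun x => ?_
    · have h0 : Q w w = 0 := hQ w
      simp [formTensor_apply, h0]
    · refine (LinearMap.congr_fun hgc x).trans ?_
      rw [rankOnePerturbation_apply, LinearMap.smul_apply, formTensor_apply, smul_smul]
  · left
    refine splitsOrthogonally_of_subset (k := ℂ) (c := 1)
      (fun N hN hNT => hM ▸ algebraicHull_le hG hT hN hNT)
      (isAlgebraicSubgroup_subspaceStabilizer U) ?_ hUtop fun δ hδ => ?_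
    -- If `U = 0`, maximality against the lines `ℂ δ` forces all of `R` to be zero, so `V = 0 = U`,
    -- contrary to `U ≠ ⊤`.
    · intro hbot
      apply hUtop
      rw [hbot, ← hspan, eq_comm, Submodule.span_eq_bot]
      intro δ hδ
      by_contra hδ0
      refine hmax (Submodule.span ℂ {δ}) ?_ ?_
      · intro x hx y hy
        obtain ⟨a, rfl⟩ := Submodule.mem_span_singleton.1 hx
        obtain ⟨a', rfl⟩ := Submodule.mem_span_singleton.1 hy
        have h1 : formSymm Q (a • δ) (a' • δ) = (2 * a * a') • formTensor Q δ δ := by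
          ext x
          simp only [formSymm_apply, formTensor_apply, map_smul, LinearMap.smul_apply,
            smul_eq_mul]
          module
        rw [h1]
        exact hL.smul_mem hMalg _ (hδL δ hδ)
      · rw [hbot, bot_lt_iff_ne_bot, Ne, Submodule.span_singleton_eq_bot]
        exact hδ0
    · exact (habsorb δ hδ).imp id fun h => Submodule.mem_orthogonalBilin_iff.2 h

end Symplectic

/-! ### Orthogonal reflections -/

section Orthogonal

variable {V : Type*} [AddCommGroup V] [Module ℂ V] {Q : V →ₗ[ℂ] V →ₗ[ℂ] ℂ}

theorem formWedge_smul (z : ℂ) (a b : V) : formWedge Q a (z • b) = z • formWedge Q a b := by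
  ext x
  simp only [formWedge_apply, map_smul, LinearMap.smul_apply, smul_eq_mul]
  module

/-- A group with all the infinitesimal rotations through `δ` moves `δ` to every vector of the
same norm, up to sign. -/
theorem exists_mem_apply_eq_or_eq_neg (hQ : ∀ x y, Q x y = Q y x) {M : Subgroup (V ≃ₗ[ℂ] V)}
    {L : Submodule ℝ (Module.End ℂ V)} (hL : IsLieAlgebraOf M L) {δ : V} (hδ : Q δ δ = 2)
    (hall : ∀ v, Q δ v = 0 → formWedge Q δ v ∈ L) {w : V} (hw : Q w w = 2) :
    ∃ m ∈ M, m δ = w ∨ m δ = -w := by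
  -- Here `w - δ` is isotropic and orthogonal to `δ`; the rotation of `δ` towards it sends `δ` to `w
  -- - δ` and then to 0, so its exponential sends `δ` to `w`.
  have hunip : ∀ w, Q w w = 2 → Q δ w = 2 → ∃ m ∈ M, m δ = w := by
    intro w hw hδw
    have h1 : Q δ (w - δ) = 0 := by rw [map_sub, hδw, hδ, sub_self]
    have h2 : Q (w - δ) (w - δ) = 0 := by
      rw [map_sub, map_sub, LinearMap.sub_apply, LinearMap.sub_apply, hQ w δ, hw, hδ, hδw]
      ring
    have hX := hall ((2⁻¹ : ℂ) • (w - δ)) (by rw [map_smul, h1, smul_zero])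
    obtain ⟨m, hm, -, hmx⟩ := hL.exists_exp _ hX
    have hXδ : formWedge Q δ ((2⁻¹ : ℂ) • (w - δ)) δ = w - δ := by
      rw [formWedge_apply, map_smul, h1, hδ, smul_zero, zero_smul, sub_zero, smul_smul,
        mul_inv_cancel₀ two_ne_zero, one_smul]
    refine ⟨m, hm, ?_⟩
    rw [hmx δ, hXδ, add_sub_cancel]
    rw [hXδ, formWedge_apply, map_smul, h2, hQ, h1, zero_smul, smul_zero, zero_smul, sub_zero]
  -- A complex angle between `δ` and `w`. If its sine vanishes, `w` or `-w` falls under the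
  -- unipotent case.
  obtain ⟨θ, hθ⟩ := Complex.cos_surjective (Q δ w / 2)
  have hcos : Q δ w = 2 * Complex.cos θ := by rw [hθ]; ring
  have htrig := Complex.sin_sq_add_cos_sq θ
  by_cases hs : Complex.sin θ = 0
  · rw [hs] at htrig
    have : (Complex.cos θ - 1) * (Complex.cos θ + 1) = 0 := by linear_combination htrig
    rcases mul_eq_zero.1 this with h | h
    · obtain ⟨m, hm, hmw⟩ := hunip w hw (by rw [hcos]; linear_combination 2 * h)
      exact ⟨m, hm, Or.inl hmw⟩
    · obtain ⟨m, hm, hmw⟩ := hunip (-w) (by simpa using hw)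
        (by rw [map_neg, hcos]; linear_combination -2 * h)
      exact ⟨m, hm, Or.inr hmw⟩
  · set s := Complex.sin θ with hsdef
    set c := Complex.cos θ with hcdef
    obtain ⟨u, hu⟩ : ∃ u, u = s⁻¹ • (w - c • δ) := ⟨_, rfl⟩
    have hδu : Q δ u = 0 := by
      rw [hu, map_smul, map_sub, map_smul, hδ, hcos, smul_eq_mul, smul_eq_mul]
      ring
    have huu : Q u u = 2 := by
      have h1 : Q (w - c • δ) (w - c • δ) = 2 * s ^ 2 := by
        simp only [map_sub, map_smul, LinearMap.sub_apply, LinearMap.smul_apply, smul_eq_mul,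
          hQ w δ, hw, hδ, hcos]
        linear_combination -2 * htrig
      rw [hu, map_smul, map_smul, LinearMap.smul_apply, h1, smul_eq_mul, smul_eq_mul]
      field_simp
    have hw' : w = c • δ + s • u := by
      rw [hu, smul_smul, mul_inv_cancel₀ hs, one_smul, add_sub_cancel]
    have huδ : Q u δ = 0 := (hQ _ _).trans hδu
    -- Rotation by `θ` in the plane of `δ` and `u`, both of norm 2 (hence the factor `1 / 2`); it is
    -- diagonal on `δ ± i u`.
    have hX := hall ((θ / 2) • u) (by rw [map_smul, hδu, smul_zero])
    obtain ⟨m, hm, hme, -⟩ := hL.exists_exp _ hX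
    have hXδ : formWedge Q δ ((θ / 2) • u) δ = θ • u := by
      rw [formWedge_apply, map_smul, hδu, hδ, smul_zero, zero_smul, sub_zero, smul_smul,
        mul_div_cancel₀ _ two_ne_zero]
    have hXu : formWedge Q δ ((θ / 2) • u) u = -(θ • δ) := by
      rw [formWedge_apply, map_smul, huδ, huu, zero_smul, zero_sub, smul_eq_mul,
        div_mul_cancel₀ _ two_ne_zero]
    have hI : Complex.I * Complex.I = -1 := Complex.I_mul_I
    have e1 := hme (δ - Complex.I • u) (θ * Complex.I) (by
      rw [map_sub, map_smul, hXδ, hXu, smul_sub, smul_smul, mul_assoc, hI]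
      module)
    have e2 := hme (δ + Complex.I • u) (-θ * Complex.I) (by
      rw [map_add, map_smul, hXδ, hXu, smul_add, smul_smul, mul_assoc, hI]
      module)
    rw [Complex.exp_mul_I, ← hcdef, ← hsdef, map_sub, map_smul] at e1
    rw [Complex.exp_mul_I, Complex.cos_neg, Complex.sin_neg, ← hcdef, ← hsdef, map_add,
      map_smul] at e2
    refine ⟨m, hm, Or.inl ?_⟩
    have e3 : (2 : ℂ) • m δ = (2 : ℂ) • w := by
      have : (2 : ℂ) • m δ = (m δ - Complex.I • m u) + (m δ + Complex.I • m u) := by module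
      rw [this, e1, e2, hw']
      have hI' : s = -(s * Complex.I * Complex.I) := by rw [mul_assoc, hI]; ring
      calc (c + s * Complex.I) • (δ - Complex.I • u) + (c + -s * Complex.I) • (δ + Complex.I • u)
          = (2 * c) • δ + (2 * -(s * Complex.I * Complex.I)) • u := by module
        _ = (2 : ℂ) • (c • δ + s • u) := by
          rw [← hI']
          module
    exact smul_right_injective V (two_ne_zero (α := ℂ)) e3

theorem orthogonal_trichotomy [FiniteDimensional ℂ V] {R : Set V} {M : Subgroup (V ≃ₗ[ℂ] V)}
    (hQ : ∀ x y, Q x y = Q y x)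
    (hn : Q.Nondegenerate) (hspan : Submodule.span ℂ R = ⊤) (hR : ∀ δ ∈ R, Q δ δ = 2)
    (hM : M = algebraicHull ℂ (isometryGroup Q) ((fun δ => rankOnePerturbation Q (-1) δ) '' R)) :
    SplitsOrthogonally Q M R ∨ Finite M ∨ M = isometryGroup Q := by
  have hG := isAlgebraicSubgroup_isometryGroup_bilinear Q
  have hT : ∀ t ∈ (fun δ => rankOnePerturbation Q (-1) δ) '' R,
      ∃ g ∈ isometryGroup Q, (g : V →ₗ[ℂ] V) = t := by
    rintro _ ⟨δ, hδ, rfl⟩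
    refine exists_mem_isometryGroup hn (rankOnePerturbation_isometry hQ ?_)
    rw [hR δ hδ, RingHom.id_apply]
    norm_num
  have hleast := isLeast_algebraicHull ℂ _ _ hG hT
  rw [← hM] at hleast
  obtain ⟨⟨hMG, hMalg, hMT⟩, -⟩ := hleast
  obtain ⟨L, hL⟩ := exists_isLieAlgebraOf hMalg.real_of_complex
  by_cases hS : SplitsOrthogonally Q M R
  · exact Or.inl hS
  by_cases hfin : Finite M
  · exact Or.inr (Or.inl hfin)
  refine Or.inr (Or.inr ?_)
  have hskew : ∀ X ∈ L, ∀ x y, Q (X x) y = -Q x (X y) := fun X hX x y =>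
    hL.skew (fun _ => rfl) hMG hX x y
  have hR0 : ∀ δ ∈ R, Q δ δ ≠ 0 := fun δ hδ => by
    rw [hR δ hδ]
    exact two_ne_zero
  have hself : ∀ X ∈ L, ∀ x, Q (X x) x = 0 := by
    intro X hX x
    have h1 := hskew X hX x x
    rw [hQ x] at h1
    have h2 : (2 : ℂ) * Q (X x) x = 0 := by linear_combination h1
    exact (mul_eq_zero.1 h2).resolve_left two_ne_zero
  have hcomp : ∀ X ∈ L, ∀ δ ∈ R, orthComponent Q δ (X δ) ∈ rotationSpace Q L δ := by
    intro X hX δ hδ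
    rw [orthComponent_of_orth (hself X hX δ)]
    refine ⟨(hQ _ _).trans (hself X hX δ), fun z => ?_⟩
    rw [formWedge_smul]
    refine hL.smul_mem hMalg z ?_
    obtain ⟨s, hs, hsδ⟩ := hMT _ ⟨δ, hδ, rfl⟩
    have h1 := hL.conj_mem s hs X hX
    rw [coe_inv_eq_rankOnePerturbation hQ hn (hMG hs) hsδ, hsδ,
      conj_rankOnePerturbation (hskew X hX), hself X hX δ] at h1
    -- `X δ` is orthogonal to `δ`, so the difference between `X` and its conjugate by the reflection
    -- is exactly the rotation of `δ` into `X δ`.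
    have h2 := L.sub_mem hX h1
    have h3 : X - (X + (RingHom.id ℂ) (-1) • formTensor Q δ (X δ) -
        (-1 : ℂ) • formTensor Q (X δ) δ +
        (-1 * (RingHom.id ℂ) (-1) * 0 : ℂ) • formTensor Q δ δ) = formWedge Q δ (X δ) := by
      rw [formWedge, RingHom.id_apply]
      module
    rwa [h3] at h2
  have hsplit : ∀ U : Submodule ℂ V, U ≠ ⊥ →
      R ⊆ (U : Set V) ∪ (U.orthogonalBilin Q : Set V) → U = ⊤ := by
    intro U hU hRU
    by_contra htop
    exact hS (splitsOrthogonally_of_subset (k := ℂ)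
      (fun N hN hNT => hM ▸ algebraicHull_le hG hT hN hNT)
      (isAlgebraicSubgroup_subspaceStabilizer U) hU htop hRU)
  obtain ⟨X, hX, hX0⟩ := L.ne_bot_iff.1 (hL.ne_bot (not_finite_iff_infinite.1 hfin))
  obtain ⟨δ, hδ, hXδ⟩ : ∃ δ ∈ R, X δ ≠ 0 := by
    by_contra! h
    refine hX0 (LinearMap.ext fun x => ?_)
    have : Submodule.span ℂ R ≤ LinearMap.ker X := Submodule.span_le.2 h
    exact this (hspan ▸ Submodule.mem_top : x ∈ Submodule.span ℂ R)
  have hD : rotationSpace Q L δ ≠ ⊥ := by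
    intro h
    have h1 := hcomp X hX δ hδ
    rw [orthComponent_of_orth (hself X hX δ), h, Submodule.mem_bot] at h1
    exact hXδ h1
  have hall : ∀ v, Q δ v = 0 → formWedge Q δ v ∈ L := fun v hv =>
    formWedge_mem_of_mem_rotationSpace (mem_rotationSpace_of_orth hQ hn (fun _ => rfl) hspan hcomp
      hL.bracket_mem hR0 hsplit hδ hD hv)
  obtain ⟨s, hs, hsδ⟩ := hMT _ ⟨δ, hδ, rfl⟩
  refine le_antisymm hMG (isometryGroup_le_of_quasiReflection_mem hQ hn fun g hg c w hw hgc => ?_)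
  have happ : ∀ x, g x = x + (c * Q x w) • w := fun x => LinearMap.congr_fun hgc x
  have hsapp : ∀ x, s x = x + (-1 * Q x δ) • δ := fun x => LinearMap.congr_fun hsδ x
  -- An isometry along anisotropic `w` is either the identity or the reflection, which is conjugate
  -- in `M` to the one along `δ`.
  have hc : c * (c * Q w w + 2) = 0 := by
    have h1 := form_apply_isometry hg w w
    rw [happ] at h1
    simp only [map_add, map_smul, LinearMap.add_apply, LinearMap.smul_apply, smul_eq_mul] at h1
    have h2 : c * (c * Q w w + 2) * Q w w ^ 2 = 0 := by linear_combination h1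
    exact (mul_eq_zero.1 h2).resolve_right (pow_ne_zero 2 hw)
  rcases mul_eq_zero.1 hc with h | h
  · have : g = 1 := LinearEquiv.ext fun x => by
      rw [happ, h, zero_mul, zero_smul, add_zero]
      rfl
    rw [this]
    exact M.one_mem
  · obtain ⟨r, hr⟩ := IsAlgClosed.exists_pow_nat_eq (2 / Q w w) (n := 2) two_pos
    have hrw : Q (r • w) (r • w) = 2 := by
      rw [map_smul, map_smul, LinearMap.smul_apply, smul_eq_mul, smul_eq_mul, ← mul_assoc,
        ← pow_two, hr, div_mul_cancel₀ _ hw]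
    have hcr : c = -r ^ 2 := by
      rw [hr]
      field_simp
      linear_combination h
    obtain ⟨m, hm, hmδ⟩ := exists_mem_apply_eq_or_eq_neg hQ hL (hR δ hδ) hall hrw
    have hgm : g = m * s * m⁻¹ := by
      ext x
      have e : m (m⁻¹ x) = x := m.apply_symm_apply x
      have h1 : Q (m⁻¹ x) δ = Q x (m δ) := by
        rw [← form_apply_isometry (hMG hm) (m⁻¹ x) δ, e]
      rw [LinearEquiv.mul_apply, LinearEquiv.mul_apply, hsapp, map_add, e, map_smul, h1, happ,
        hcr]
      rcases hmδ with h | h <;> rw [h]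
      · simp only [map_smul, smul_eq_mul]
        module
      · simp only [map_smul, map_neg, smul_eq_mul]
        module
    rw [hgm]
    exact M.mul_mem (M.mul_mem hm hs) (M.inv_mem hm)

end Orthogonal

/-! ### Complex reflections -/

section Unitary

variable {V : Type*} [AddCommGroup V] [Module ℂ V] {h : V →ₗ[ℂ] V →ₗ⋆[ℂ] ℂ}

open Complex

theorem formWedge_real_smul (r : ℝ) (a b : V) :
    formWedge h a ((r : ℂ) • b) = r • formWedge h a b := by
  ext x
  change h x a • ((r : ℂ) • b) - h x ((r : ℂ) • b) • a = (r : ℂ) • (h x a • b - h x b • a)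
  rw [LinearMap.map_smulₛₗ, conj_ofReal, smul_eq_mul]
  module

/-- `L` is only a real subspace here; as `ζ` is not real, `1` and `ζ` span `ℂ` over `ℝ`. -/
theorem formWedge_smul_mem_of_smul_mem {L : Submodule ℝ (Module.End ℂ V)} {δ v : V} {ζ : ℂ}
    (hζ : ζ.im ≠ 0) (hv : formWedge h δ v ∈ L) (hv' : formWedge h δ (ζ • v) ∈ L) (z : ℂ) :
    formWedge h δ (z • v) ∈ L := by
  have hz : z = ((z.re - z.im / ζ.im * ζ.re : ℝ) : ℂ) + ((z.im / ζ.im : ℝ) : ℂ) * ζ := by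
    apply Complex.ext
    · simp
    · simp [hζ]
  rw [hz, add_smul, mul_smul, formWedge_add, formWedge_real_smul, formWedge_real_smul]
  exact L.add_mem (L.smul_mem _ hv) (L.smul_mem _ hv')

theorem formWedge_bracket {δ a b : V} (hB : ∀ x y, h x y = starRingEnd ℂ (h y x)) {e : ℂ}
    (hδ : h δ δ = e) (ha : h δ a = 0) (hb : h δ b = 0) :
    formWedge h δ a * formWedge h δ (I • b) - formWedge h δ (I • b) * formWedge h δ a =
      (I * e) • (formTensor h a b + formTensor h b a) -
        (I * (h a b + h b a)) • formTensor h δ δ := by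
  have ha' : h a δ = 0 := form_eq_zero_symm hB ha
  have hb' : h b δ = 0 := form_eq_zero_symm hB hb
  ext x
  simp only [LinearMap.sub_apply, LinearMap.add_apply, LinearMap.smul_apply,
    Module.End.mul_apply, formWedge_apply, formTensor_apply, map_sub, map_smul,
    LinearMap.map_smulₛₗ, smul_eq_mul, ha, hb, ha', hb', hδ, conj_I]
  module

/-- `y ↦ h(·, y)` is conjugate-linear, so injectivity is turned into surjectivity by counting real
dimensions. -/
theorem exists_form_eq_dual [FiniteDimensional ℂ V] (hn : h.Nondegenerate) (φ : Module.Dual ℂ V) :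
    ∃ y, ∀ x, h x y = φ x := by
  let Ψ : V →ₗ[ℝ] Module.Dual ℂ V :=
    { toFun := fun y => h.flip y
      map_add' := fun y z => map_add _ _ _
      map_smul' := fun r y => by
        ext x
        change h x ((r : ℂ) • y) = (r : ℂ) * h x y
        rw [LinearMap.map_smulₛₗ, conj_ofReal, smul_eq_mul] }
  have hinj : Function.Injective Ψ := by
    rw [injective_iff_map_eq_zero]
    exact fun y hy => hn.2 y fun x => LinearMap.congr_fun hy x
  have hdim : Module.finrank ℝ V = Module.finrank ℝ (Module.Dual ℂ V) := by
    rw [finrank_real_of_complex, finrank_real_of_complex, Subspace.dual_finrank_eq]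
  obtain ⟨y, hy⟩ := (LinearMap.injective_iff_surjective_of_finrank_eq_finrank hdim).1 hinj φ
  exact ⟨y, fun x => LinearMap.congr_fun hy x⟩

/-- Sum the brackets of rotations over a basis and its `h`-dual basis, both projected to `δ^⊥` by
`P`. The tensors add up to `P` and the scalar terms to its trace `dim V - 1`; the result has trace
zero. -/
theorem scalar_sub_formTensor_mem [FiniteDimensional ℂ V]
    (hB : ∀ x y, h x y = starRingEnd ℂ (h y x)) (hn : h.Nondegenerate)
    {L : Submodule ℝ (Module.End ℂ V)} (hbr : ∀ X ∈ L, ∀ Y ∈ L, X * Y - Y * X ∈ L) {δ : V} {e : ℝ}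
    (he : e * e = 1) (hδ : h δ δ = e) (hall : ∀ v, h δ v = 0 → formWedge h δ v ∈ L) :
    (2 * I * e) • (1 : Module.End ℂ V) - (2 * I * (Module.finrank ℂ V : ℂ)) • formTensor h δ δ
      ∈ L := by
  have he' : (e : ℂ) * e = 1 := by exact_mod_cast he
  let P : Module.End ℂ V := 1 - (e : ℂ) • formTensor h δ δ
  have hP : ∀ x, P x = x - ((e : ℂ) * h x δ) • δ := fun x => by
    change x - (e : ℂ) • (h x δ • δ) = _
    rw [smul_smul]
  have hPδ : ∀ x, h (P x) δ = 0 := fun x => by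
    rw [hP, map_sub, LinearMap.sub_apply, map_smul, LinearMap.smul_apply, hδ, smul_eq_mul]
    linear_combination -(h x δ) * he'
  have hPδ' : ∀ x, h δ (P x) = 0 := fun x => form_eq_zero_symm hB (hPδ x)
  have hPfix : ∀ x, h x δ = 0 → P x = x := fun x hx => by
    rw [hP, hx, mul_zero, zero_smul, sub_zero]
  have hPsa : ∀ x y, h x (P y) = h (P x) y := by
    intro x y
    rw [hP, hP, map_sub, map_sub, LinearMap.sub_apply, LinearMap.map_smulₛₗ (h x), map_smul,
      LinearMap.smul_apply, map_mul, conj_ofReal, ← hB δ y, smul_eq_mul, smul_eq_mul]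
    ring
  let b := Module.finBasis ℂ V
  choose f hf using fun j => exists_form_eq_dual hn (b.coord j)
  have hdual : ∀ x, ∑ j, h x (f j) • b j = x := fun x => by
    simp only [hf]
    exact b.sum_repr x
  have h1 : ∑ j, formTensor h (P (f j)) (P (b j)) = P := by
    ext x
    rw [LinearMap.sum_apply]
    simp only [formTensor_apply, hPsa]
    calc ∑ j, h (P x) (f j) • P (b j) = P (∑ j, h (P x) (f j) • b j) := by
          rw [map_sum]
          simp only [map_smul]
      _ = P x := by rw [hdual, hPfix _ (hPδ x)]
  have h2 : ∑ j, formTensor h (P (b j)) (P (f j)) = P := by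
    ext x
    refine sub_eq_zero.1 (hn.2 _ fun y => ?_)
    rw [map_sub, LinearMap.sum_apply, map_sum, sub_eq_zero]
    simp only [formTensor_apply, LinearMap.map_smulₛₗ, ← hB, smul_eq_mul]
    calc ∑ j, h (P (b j)) x * h y (P (f j)) = h (∑ j, h (P y) (f j) • P (b j)) x := by
          rw [map_sum, LinearMap.sum_apply]
          simp only [map_smul, LinearMap.smul_apply, smul_eq_mul, hPsa, mul_comm]
      _ = h (P y) x := by
          congr 2
          have := congrArg P (hdual (P y))
          rw [map_sum, hPfix _ (hPδ y)] at this
          simpa only [map_smul] using this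
      _ = h y (P x) := (hPsa y x).symm
  have h3 : ∑ j, h (P (b j)) (P (f j)) = (Module.finrank ℂ V : ℂ) - 1 := by
    have : ∀ j, h (P (b j)) (P (f j)) = 1 - e * h (h δ (f j) • b j) δ := by
      intro j
      rw [hPsa, hPfix _ (hPδ _), hP, map_sub, LinearMap.sub_apply, map_smul, map_smul,
        LinearMap.smul_apply, LinearMap.smul_apply, hf, hf, Module.Basis.coord_apply,
        Module.Basis.repr_self, Finsupp.single_eq_same, smul_eq_mul, smul_eq_mul]
      ring
    simp only [this]
    rw [Finset.sum_sub_distrib, ← Finset.mul_sum, ← LinearMap.sum_apply, ← map_sum, hdual, hδ, he']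
    simp
  have h4 : ∑ j, h (P (f j)) (P (b j)) = (Module.finrank ℂ V : ℂ) - 1 := by
    have := congrArg (starRingEnd ℂ) h3
    rw [map_sum, map_sub, map_one, map_natCast] at this
    simpa only [← hB] using this
  have hmem : ∑ j, (formWedge h δ (P (b j)) * formWedge h δ (I • P (f j)) -
      formWedge h δ (I • P (f j)) * formWedge h δ (P (b j))) ∈ L :=
    L.sum_mem fun j _ => hbr _ (hall _ (hPδ' _)) _
      (hall _ (by rw [LinearMap.map_smulₛₗ, hPδ', smul_zero]))
  have hsum : ∑ j, (formWedge h δ (P (b j)) * formWedge h δ (I • P (f j)) -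
      formWedge h δ (I • P (f j)) * formWedge h δ (P (b j))) =
      (2 * I * e) • (1 : Module.End ℂ V) -
        (2 * I * (Module.finrank ℂ V : ℂ)) • formTensor h δ δ := by
    simp only [formWedge_bracket hB hδ (hPδ' _) (hPδ' _)]
    rw [Finset.sum_sub_distrib, ← Finset.smul_sum, Finset.sum_add_distrib, h1, h2,
      ← Finset.sum_smul, ← Finset.mul_sum, Finset.sum_add_distrib, h3, h4]
    have : (2 * I * e * e) • formTensor h δ δ = (2 * I) • formTensor h δ δ := by
      rw [mul_assoc, he', mul_one]
    calc (I * e) • (P + P) - (I * ((Module.finrank ℂ V : ℂ) - 1 + ((Module.finrank ℂ V : ℂ) - 1))) •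
          formTensor h δ δ
        = (2 * I * e) • (1 : Module.End ℂ V) - (2 * I * e * e) • formTensor h δ δ -
          (2 * I * ((Module.finrank ℂ V : ℂ) - 1)) • formTensor h δ δ := by
          simp only [P]
          module
      _ = _ := by
          rw [this]
          module
  rwa [hsum] at hmem

/-- Up to scalars, `L` contains the generators of all the rotations around hyperplanes. -/
theorem I_smul_formTensor_self_mem [FiniteDimensional ℂ V]
    (hB : ∀ x y, h x y = starRingEnd ℂ (h y x)) (hn : h.Nondegenerate)
    {L : Submodule ℝ (Module.End ℂ V)} (hbr : ∀ X ∈ L, ∀ Y ∈ L, X * Y - Y * X ∈ L) {δ : V} {e : ℝ}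
    (he : e * e = 1) (hδ : h δ δ = e) (hall : ∀ v, h δ v = 0 → formWedge h δ v ∈ L) (w : V) :
    I • formTensor h w w ∈ L ⊔ Submodule.span ℝ {I • (1 : Module.End ℂ V)} := by
  have he' : (e : ℂ) * e = 1 := by exact_mod_cast he
  set L' := L ⊔ Submodule.span ℝ {I • (1 : Module.End ℂ V)} with hL'
  have hle : L ≤ L' := le_sup_left
  have hone : I • (1 : Module.End ℂ V) ∈ L' :=
    Submodule.mem_sup_right (Submodule.mem_span_singleton_self _)
  have hδ0 : δ ≠ 0 := by
    rintro rfl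
    rw [map_zero] at hδ
    rw [← hδ] at he'
    simp at he'
  have hpos : 0 < Module.finrank ℂ V :=
    Module.finrank_pos_iff_exists_ne_zero.2 ⟨δ, hδ0⟩
  have hn0 : ((Module.finrank ℂ V : ℝ) : ℂ) ≠ 0 := by
    exact_mod_cast hpos.ne'
  have hδmem : I • formTensor h δ δ ∈ L' := by
    have h1 := hle (scalar_sub_formTensor_mem hB hn hbr he hδ hall)
    have h2 := L'.sub_mem (L'.smul_mem (e / Module.finrank ℂ V : ℝ) hone)
      (L'.smul_mem (1 / (2 * Module.finrank ℂ V) : ℝ) h1)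
    convert h2 using 1
    change _ = ((e / Module.finrank ℂ V : ℝ) : ℂ) • (I • (1 : Module.End ℂ V)) -
      ((1 / (2 * Module.finrank ℂ V) : ℝ) : ℂ) • _
    rw [smul_sub, smul_smul, smul_smul, smul_smul]
    have e1 : ((e / Module.finrank ℂ V : ℝ) : ℂ) * I =
        ((1 / (2 * Module.finrank ℂ V) : ℝ) : ℂ) * (2 * I * e) := by
      push_cast at hn0 ⊢
      field_simp
    have e2 : ((1 / (2 * Module.finrank ℂ V) : ℝ) : ℂ) * (2 * I * (Module.finrank ℂ V : ℂ)) = I := by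
      push_cast at hn0 ⊢
      field_simp
    rw [e1, e2]
    module
  have horth : ∀ a, h δ a = 0 → I • formTensor h a a ∈ L' := by
    intro a ha
    -- This bracket is `2 i e (a ⊗ a) - 2 i h(a, a) (δ ⊗ δ)`.
    have h1 := hbr _ (hall a ha) _ (hall (I • a) (by rw [LinearMap.map_smulₛₗ, ha, smul_zero]))
    rw [formWedge_bracket hB hδ ha ha] at h1
    have hr : h a a = ((h a a).re : ℂ) := (conj_eq_iff_re.1 (hB a a).symm).symm
    have h2 := L'.add_mem (L'.smul_mem (e / 2) (hle h1)) (L'.smul_mem (e * (h a a).re) hδmem)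
    convert h2 using 1
    change _ = ((e / 2 : ℝ) : ℂ) • ((I * e) • (formTensor h a a + formTensor h a a) -
      (I * (h a a + h a a)) • formTensor h δ δ) +
      ((e * (h a a).re : ℝ) : ℂ) • (I • formTensor h δ δ)
    rw [hr]
    generalize (h a a).re = r
    push_cast
    calc I • formTensor h a a = (((e : ℂ) * e) * I) • formTensor h a a := by rw [he', one_mul]
      _ = _ := by
        module
  set z : ℂ := e * h w δ with hz
  set a : V := w - z • δ with ha
  have haδ : h a δ = 0 := by
    rw [ha, map_sub, LinearMap.sub_apply, map_smul, LinearMap.smul_apply, hδ, smul_eq_mul]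
    linear_combination -(h w δ) * he'
  have hδa : h δ a = 0 := form_eq_zero_symm hB haδ
  have hw : w = z • δ + a := by rw [ha, add_sub_cancel]
  -- In `w ⊗ w` with `w = z δ + a`, the cross terms times `i` are the rotation of `δ` into `i z̄ a`.
  have h1 := L'.add_mem (L'.add_mem (L'.smul_mem (normSq z) hδmem) (horth a hδa))
    (hle (hall ((I * starRingEnd ℂ z) • a) (by rw [LinearMap.map_smulₛₗ, hδa, smul_zero])))
  convert h1 using 1
  change _ = ((normSq z : ℝ) : ℂ) • (I • formTensor h δ δ) + _ + _
  rw [normSq_eq_conj_mul_self, hw]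
  generalize z = z
  generalize a = a
  ext x
  simp only [LinearMap.add_apply, LinearMap.smul_apply, formTensor_apply, formWedge_apply, map_add,
    LinearMap.map_smulₛₗ, map_mul, conj_I, conj_conj, smul_eq_mul]
  module

/-- The automorphisms that lie in `M` up to a scalar of modulus one. -/
def unitScalarExtension (M : Subgroup (V ≃ₗ[ℂ] V)) : Subgroup (V ≃ₗ[ℂ] V) where
  carrier := {g | ∃ u : ℂ, ‖u‖ = 1 ∧ ∃ m ∈ M, ∀ x, g x = u • m x}
  one_mem' := ⟨1, norm_one, 1, M.one_mem, fun x => (one_smul ℂ x).symm⟩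
  mul_mem' := by
    rintro g g' ⟨u, hu, m, hm, hg⟩ ⟨u', hu', m', hm', hg'⟩
    refine ⟨u * u', by rw [norm_mul, hu, hu', one_mul], m * m', M.mul_mem hm hm', fun x => ?_⟩
    rw [LinearEquiv.mul_apply, hg, hg', map_smul, smul_smul]
    rfl
  inv_mem' := by
    rintro g ⟨u, hu, m, hm, hg⟩
    have hu0 : u ≠ 0 := by
      rintro rfl
      simp at hu
    refine ⟨u⁻¹, by rw [norm_inv, hu, inv_one], m⁻¹, M.inv_mem hm, fun x => ?_⟩
    apply g.injective
    have e1 : g (g⁻¹ x) = x := g.apply_symm_apply x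
    have e2 : m (m⁻¹ x) = x := m.apply_symm_apply x
    rw [e1, hg, map_smul, e2, smul_smul, mul_inv_cancel₀ hu0, one_smul]

theorem projectiveImage_eq_top {M : Subgroup (V ≃ₗ[ℂ] V)} (hM : M ≤ isometryGroup h)
    (hall : isometryGroup h ≤ unitScalarExtension M) : projectiveImage h M = ⊤ := by
  rw [eq_top_iff]
  rintro q -
  obtain ⟨⟨g, hg⟩, rfl⟩ := QuotientGroup.mk_surjective q
  obtain ⟨u, hu, m, hm, hgm⟩ := hall hg
  refine ⟨⟨m, hM hm⟩, hm, ?_⟩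
  refine QuotientGroup.eq.2 (Subgroup.mem_center_iff.2 ?_)
  rintro ⟨k, hk⟩
  have key : ∀ x, (m⁻¹ * g) x = u • x := fun x => by
    have e : m⁻¹ (m x) = x := m.symm_apply_apply x
    rw [LinearEquiv.mul_apply, hgm, map_smul, e]
  apply Subtype.ext
  change k * (m⁻¹ * g) = m⁻¹ * g * k
  ext x
  change k ((m⁻¹ * g) x) = (m⁻¹ * g) (k x)
  rw [key, key, map_smul]

/-- A quasi-reflection multiplies `w` by some `e^{iθ}` and fixes `w^⊥`, so it is the exponential of
`(θ / h(w, w)) i w ⊗ w`. That generator is in `L` up to a summand `i τ`, which changes the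
exponential by a scalar of modulus one. -/
theorem isometryGroup_le_unitScalarExtension [FiniteDimensional ℂ V]
    (hB : ∀ x y, h x y = starRingEnd ℂ (h y x)) (hn : h.Nondegenerate)
    {M : Subgroup (V ≃ₗ[ℂ] V)} {L : Submodule ℝ (Module.End ℂ V)} (hL : IsLieAlgebraOf M L)
    (hall : ∀ w, I • formTensor h w w ∈ L ⊔ Submodule.span ℝ {I • (1 : Module.End ℂ V)}) :
    isometryGroup h ≤ unitScalarExtension M := by
  refine isometryGroup_le_of_quasiReflection_mem hB hn fun g hg c w hw hgc => ?_
  have happ : ∀ x, g x = x + (c * h x w) • w := fun x => LinearMap.congr_fun hgc x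
  have hr : h w w = ((h w w).re : ℂ) := (conj_eq_iff_re.1 (hB w w).symm).symm
  have hr0 : (h w w).re ≠ 0 := fun h0 => hw (by rw [hr, h0, ofReal_zero])
  have hgw : g w = (1 + c * h w w) • w := by rw [happ, add_smul, one_smul]
  have hnorm : ‖1 + c * h w w‖ = 1 := by
    have h1 := form_apply_isometry hg w w
    rw [hgw, LinearMap.map_smulₛₗ, map_smul, LinearMap.smul_apply, smul_eq_mul, smul_eq_mul,
      ← mul_assoc] at h1
    have h2 : starRingEnd ℂ (1 + c * h w w) * (1 + c * h w w) = 1 :=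
      mul_right_cancel₀ hw (h1.trans (one_mul _).symm)
    rw [← normSq_eq_conj_mul_self] at h2
    have h3 : normSq (1 + c * h w w) = 1 := by exact_mod_cast h2
    rw [normSq_eq_norm_sq] at h3
    exact (pow_eq_one_iff_of_nonneg (norm_nonneg _) two_ne_zero).1 h3
  obtain ⟨θ, hθ⟩ := (norm_eq_one_iff _).1 hnorm
  obtain ⟨X, hX, Y, hY, hXY⟩ := Submodule.mem_sup.1
    (Submodule.smul_mem _ (θ / (h w w).re) (hall w))
  obtain ⟨τ, rfl⟩ := Submodule.mem_span_singleton.1 hY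
  have hXapp : ∀ x, X x = ((θ / (h w w).re : ℝ) : ℂ) • (I • (h x w • w)) - (τ : ℂ) • (I • x) := by
    intro x
    have := LinearMap.congr_fun hXY x
    exact eq_sub_of_add_eq this
  obtain ⟨m, hm, hme, -⟩ := hL.exists_exp X hX
  have hmw : m w = exp (-(τ * I)) • ((1 + c * h w w) • w) := by
    rw [hme w (-(τ * I) + θ * I), exp_add, mul_smul, hθ]
    rw [hXapp, hr]
    have : ((θ / (h w w).re : ℝ) : ℂ) * I * ((h w w).re : ℂ) = θ * I := by
      have : ((h w w).re : ℂ) ≠ 0 := ofReal_ne_zero.2 hr0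
      push_cast
      field_simp
    rw [add_smul, ← this]
    module
  have hmx : ∀ x, h x w = 0 → m x = exp (-(τ * I)) • x := by
    intro x hx
    refine hme x _ ?_
    rw [hXapp, hx]
    module
  refine ⟨exp (τ * I), norm_exp_ofReal_mul_I τ, m, hm, fun x => ?_⟩
  have hx : x = (x - (h x w / h w w) • w) + (h x w / h w w) • w := (sub_add_cancel _ _).symm
  have hx0 : h (x - (h x w / h w w) • w) w = 0 := by
    rw [map_sub, LinearMap.sub_apply, map_smul, LinearMap.smul_apply, smul_eq_mul,
      div_mul_cancel₀ _ hw, sub_self]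
  have hmg : m x = exp (-(τ * I)) • g x := by
    conv_lhs => rw [hx, map_add, map_smul, hmx _ hx0, hmw]
    conv_rhs => rw [hx, map_add, map_smul, hgw, happ, hx0]
    module
  rw [hmg, smul_smul, ← exp_add, add_neg_cancel, exp_zero, one_smul]

theorem pow_det_eq_one_of_rankOnePerturbation {e ζ : ℂ} (he : e * e = 1) {δ : V} (hδ : h δ δ = e)
    {n : ℕ} (hζ : ζ ^ n = 1) {g : V ≃ₗ[ℂ] V}
    (hg : (g : V →ₗ[ℂ] V) = rankOnePerturbation h (e * (ζ - 1)) δ) :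
    g ∈ detPowOneSubgroup V n := by
  have happ : ∀ x, (g : V →ₗ[ℂ] V) x = x + (e * (ζ - 1) * h x δ) • δ := fun x =>
    LinearMap.congr_fun hg x
  have hpow : ∀ (j : ℕ) x, ((g : V →ₗ[ℂ] V) ^ j) x = x + (e * (ζ ^ j - 1) * h x δ) • δ := by
    intro j
    induction j with
    | zero => simp
    | succ j ih =>
      intro x
      rw [pow_succ', Module.End.mul_apply, ih, happ]
      simp only [map_add, LinearMap.add_apply, map_smul, LinearMap.smul_apply, smul_eq_mul, hδ]
      have : (e * (ζ - 1) * (h x δ + e * (ζ ^ j - 1) * h x δ * e)) =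
          e * (ζ ^ (j + 1) - 1) * h x δ - e * (ζ ^ j - 1) * h x δ := by
        linear_combination (e * (ζ - 1) * (ζ ^ j - 1) * h x δ) * he
      rw [this]
      module
  rw [mem_detPowOneSubgroup, ← map_pow]
  have : (g : V →ₗ[ℂ] V) ^ n = 1 := by
    ext x
    rw [hpow, hζ, sub_self, mul_zero, zero_mul, zero_smul, add_zero]
    rfl
  rw [this, map_one]

theorem unitary_trichotomy [FiniteDimensional ℂ V] {ε ζ : ℂ} {R : Set V}
    {M : Subgroup (V ≃ₗ[ℂ] V)} (hε : ε = 1 ∨ ε = -1)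
    (hB : ∀ x y, h x y = starRingEnd ℂ (h y x)) (hn : h.Nondegenerate)
    (hspan : Submodule.span ℂ R = ⊤) (hζ : ∃ n : ℕ, 0 < n ∧ ζ ^ n = 1) (hζ1 : ζ ≠ 1)
    (hζ2 : ζ ≠ -1) (hR : ∀ δ ∈ R, h δ δ = ε)
    (hM : M = algebraicHull ℝ (isometryGroup h)
      ((fun δ => rankOnePerturbation h (ε * (ζ - 1)) δ) '' R))
    (hdim : 0 < Module.finrank ℂ V) :
    SplitsOrthogonally h M R ∨ Finite M ∨ projectiveImage h M = ⊤ := by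
  obtain ⟨e, he, rfl⟩ : ∃ e : ℝ, e * e = 1 ∧ ε = (e : ℂ) := by
    rcases hε with h | h
    · exact ⟨1, by norm_num, by rw [h, ofReal_one]⟩
    · exact ⟨-1, by norm_num, by rw [h, ofReal_neg, ofReal_one]⟩
  have he' : (e : ℂ) * e = 1 := by exact_mod_cast he
  have he0 : (e : ℂ) ≠ 0 := left_ne_zero_of_mul_eq_one he'
  obtain ⟨n, hn0, hζn⟩ := hζ
  have hζnorm : starRingEnd ℂ ζ * ζ = 1 := by
    rw [← normSq_eq_conj_mul_self, normSq_eq_norm_sq,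
      Complex.norm_eq_one_of_pow_eq_one hζn hn0.ne']
    norm_num
  -- A root of unity other than `±1` is not real, and so neither is `ζ̄ - 1`: this is what makes
  -- rotation spaces complex.
  have hζim : (starRingEnd ℂ ζ - 1).im ≠ 0 := by
    intro h0
    have h1 : starRingEnd ℂ ζ = ζ := by
      rw [conj_eq_iff_im]
      simpa using h0
    rw [h1] at hζnorm
    rcases mul_self_eq_one_iff.1 hζnorm with h | h
    · exact hζ1 h
    · exact hζ2 h
  have hζ0 : starRingEnd ℂ ζ - 1 ≠ 0 := fun h0 => hζim (by rw [h0, zero_im])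
  have hG := isAlgebraicSubgroup_isometryGroup_sesquilinear h
  have hT : ∀ t ∈ (fun δ => rankOnePerturbation h (e * (ζ - 1)) δ) '' R,
      ∃ g ∈ isometryGroup h, (g : V →ₗ[ℂ] V) = t := by
    rintro _ ⟨δ, hδ, rfl⟩
    refine exists_mem_isometryGroup hn (rankOnePerturbation_isometry hB ?_)
    rw [hR δ hδ, map_mul, map_sub, conj_ofReal, map_one]
    linear_combination (e * (ζ - 1) * (starRingEnd ℂ ζ - 1)) * he' + e * hζnorm
  have hleast := isLeast_algebraicHull ℝ _ _ hG hT
  rw [← hM] at hleast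
  obtain ⟨⟨hMG, hMalg, hMT⟩, -⟩ := hleast
  have hMle : ∀ N : Subgroup (V ≃ₗ[ℂ] V), IsAlgebraicSubgroup ℝ N → (∀ g : V ≃ₗ[ℂ] V,
      (g : V →ₗ[ℂ] V) ∈ (fun δ => rankOnePerturbation h (e * (ζ - 1)) δ) '' R → g ∈ N) → M ≤ N :=
    fun N hN hNT => hM ▸ algebraicHull_le hG hT hN hNT
  obtain ⟨L, hL⟩ := exists_isLieAlgebraOf hMalg
  by_cases hS : SplitsOrthogonally h M R
  · exact Or.inl hS
  by_cases hfin : Finite M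
  · exact Or.inr (Or.inl hfin)
  refine Or.inr (Or.inr ?_)
  have hskew : ∀ X ∈ L, ∀ x y, h (X x) y = -h x (X y) := fun X hX x y =>
    hL.skew conj_ofReal hMG hX x y
  have hR0 : ∀ δ ∈ R, h δ δ ≠ 0 := fun δ hδ => by rwa [hR δ hδ]
  have hconj : ∀ X ∈ L, ∀ δ ∈ R,
      formWedge h δ ((e * (starRingEnd ℂ ζ - 1)) • orthComponent h δ (X δ)) ∈ L := by
    intro X hX δ hδ
    obtain ⟨s, hs, hsδ⟩ := hMT _ ⟨δ, hδ, rfl⟩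
    have h1 := hL.conj_mem s hs X hX
    rw [coe_inv_eq_rankOnePerturbation hB hn (hMG hs) hsδ, hsδ,
      conj_rankOnePerturbation (hskew X hX)] at h1
    have h2 := L.sub_mem h1 hX
    have ha : starRingEnd ℂ (h (X δ) δ) = -h (X δ) δ := by
      rw [← hB, hskew X hX δ δ, neg_neg]
    convert h2 using 1
    ext x
    simp only [formWedge_apply, orthComponent, LinearMap.sub_apply, LinearMap.add_apply,
      LinearMap.smul_apply, formTensor_apply, map_sub, LinearMap.map_smulₛₗ, map_mul, map_div₀,
      conj_ofReal, map_one, conj_conj, smul_eq_mul, hR δ hδ, ha]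
    have hinv : ∀ y : ℂ, y / (e : ℂ) = e * y := fun y => by
      rw [div_eq_iff he0]
      linear_combination -y * he'
    rw [hinv, hinv]
    -- The coefficient of `δ ⊗ δ` cancels because `ζ̄ ζ = 1`.
    have hcoef : (e * (starRingEnd ℂ ζ - 1)) * (e * h (X δ) δ) * h x δ
        + (e * (ζ - 1)) * (e * h (X δ) δ) * h x δ
        + (e * (ζ - 1)) * (e * (starRingEnd ℂ ζ - 1)) * h (X δ) δ * h x δ = 0 := by
      linear_combination ((starRingEnd ℂ ζ - 1 + (ζ - 1) + (ζ - 1) * (starRingEnd ℂ ζ - 1)) *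
        h (X δ) δ * h x δ) * he' + (h (X δ) δ * h x δ) * hζnorm
    have hcoef' := congrArg (fun t : ℂ => t • δ) hcoef
    simp only [zero_smul] at hcoef'
    rw [← sub_eq_zero, ← neg_eq_zero, ← hcoef']
    module
  have hwedge : ∀ δ ∈ R, ∀ v, h δ v = 0 → formWedge h δ v ∈ L → ∀ z : ℂ,
      formWedge h δ (z • v) ∈ L := by
    intro δ hδ v hv hvL
    refine formWedge_smul_mem_of_smul_mem hζim hvL ?_
    -- Conjugating the rotation itself by the reflection multiplies its direction `v` by `ζ̄ - 1`.
    have h1 := hconj _ hvL δ hδ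
    rw [formWedge_apply, hv, zero_smul, sub_zero, hR δ hδ, orthComponent_of_orth (by
      rw [map_smul, LinearMap.smul_apply, form_eq_zero_symm hB hv, smul_zero]), smul_smul] at h1
    have h2 : e * (starRingEnd ℂ ζ - 1) * e = starRingEnd ℂ ζ - 1 := by
      linear_combination (starRingEnd ℂ ζ - 1) * he'
    rwa [h2] at h1
  have hcomp : ∀ X ∈ L, ∀ δ ∈ R, orthComponent h δ (X δ) ∈ rotationSpace h L δ := by
    intro X hX δ hδ
    have horth : h δ (orthComponent h δ (X δ)) = 0 := by
      apply form_eq_zero_symm hB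
      rw [orthComponent, map_sub, LinearMap.sub_apply, map_smul, LinearMap.smul_apply, smul_eq_mul,
        div_mul_cancel₀ _ (hR0 δ hδ), sub_self]
    refine ⟨horth, fun z => ?_⟩
    have h1 := hwedge δ hδ _ (by rw [LinearMap.map_smulₛₗ, horth, smul_zero]) (hconj X hX δ hδ)
      (z * (e * (starRingEnd ℂ ζ - 1))⁻¹)
    rwa [smul_smul, mul_assoc, inv_mul_cancel₀ (mul_ne_zero he0 hζ0), mul_one] at h1
  have hsplit : ∀ U : Submodule ℂ V, U ≠ ⊥ →
      R ⊆ (U : Set V) ∪ (U.orthogonalBilin h : Set V) → U = ⊤ := by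
    intro U hU hRU
    by_contra htop
    exact hS (splitsOrthogonally_of_subset (k := ℝ) hMle
      (isAlgebraicSubgroup_subspaceStabilizer U).real_of_complex hU htop hRU)
  obtain ⟨X, hX, hX0⟩ := L.ne_bot_iff.1 (hL.ne_bot (not_finite_iff_infinite.1 hfin))
  -- a nonzero element of `L` cannot be scalar, as the determinants in `M` are roots of unity
  obtain ⟨δ, hδ, hXδ⟩ : ∃ δ ∈ R, orthComponent h δ (X δ) ≠ 0 := by
    by_contra! hzero
    have heig : ∀ δ ∈ R, X δ = (h (X δ) δ / h δ δ) • δ := fun δ hδ => sub_eq_zero.1 (hzero δ hδ)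
    have himag : ∀ δ ∈ R, starRingEnd ℂ (h (X δ) δ / h δ δ) = -(h (X δ) δ / h δ δ) := by
      intro δ hδ
      rw [map_div₀, ← hB, ← hB, hskew X hX δ δ, neg_div, neg_neg]
    obtain ⟨δ₁, hδ₁⟩ : R.Nonempty := by
      rw [Set.nonempty_iff_ne_empty]
      rintro rfl
      rw [Submodule.span_empty] at hspan
      have := (Submodule.eq_bot_iff _).1 hspan.symm
      obtain ⟨x, hx⟩ := Module.finrank_pos_iff_exists_ne_zero.1 hdim
      exact hx (this x Submodule.mem_top)
    set μ := h (X δ₁) δ₁ / h δ₁ δ₁ with hμ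
    -- All elements of `R` are eigenvectors of the skew `X`, with imaginary eigenvalues; those with
    -- eigenvalue other than `μ` are orthogonal to the `μ`-eigenspace. No splitting means that `X`
    -- is the scalar `μ`.
    have htop := hsplit (LinearMap.ker (X - μ • (1 : Module.End ℂ V))) (by
        intro hbot
        have h1 : δ₁ ∈ LinearMap.ker (X - μ • (1 : Module.End ℂ V)) := by
          rw [LinearMap.mem_ker, LinearMap.sub_apply, sub_eq_zero]
          exact heig δ₁ hδ₁
        rw [hbot, Submodule.mem_bot] at h1
        exact hR0 δ₁ hδ₁ (by rw [h1, map_zero])) (by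
        intro δ hδ
        by_cases hμδ : h (X δ) δ / h δ δ = μ
        · left
          change δ ∈ LinearMap.ker _
          rw [LinearMap.mem_ker, LinearMap.sub_apply, sub_eq_zero, heig δ hδ, hμδ]
          rfl
        · right
          refine Submodule.mem_orthogonalBilin_iff.2 fun u hu => ?_
          change h u δ = 0
          rw [LinearMap.mem_ker, LinearMap.sub_apply, sub_eq_zero] at hu
          have hu' : X u = μ • u := hu
          have h1 := hskew X hX u δ
          rw [hu', heig δ hδ, map_smul, LinearMap.smul_apply, LinearMap.map_smulₛₗ, himag δ hδ,
            smul_eq_mul, smul_eq_mul] at h1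
          have h2 : (h (X δ) δ / h δ δ - μ) * h u δ = 0 := by linear_combination -h1
          exact (mul_eq_zero.1 h2).resolve_left (sub_ne_zero.2 hμδ))
    have hXμ : ∀ x, X x = μ • x := fun x => by
      have : x ∈ LinearMap.ker (X - μ • (1 : Module.End ℂ V)) := htop ▸ Submodule.mem_top
      rw [LinearMap.mem_ker, LinearMap.sub_apply, sub_eq_zero] at this
      exact this
    have hμ0 : μ ≠ 0 := by
      intro h0
      exact hX0 (LinearMap.ext fun x => by rw [hXμ, h0, zero_smul]; rfl)
    have hμI : μ = (μ.im : ℂ) * I := by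
      have h1 : μ.re = 0 := by
        have := congrArg re (himag δ₁ hδ₁)
        rw [← hμ, conj_re, neg_re] at this
        linarith
      conv_lhs => rw [← re_add_im μ, h1, ofReal_zero, zero_add]
    have him : μ.im ≠ 0 := fun h0 => hμ0 (by rw [hμI, h0, ofReal_zero, zero_mul])
    have hd : (Module.finrank ℂ V : ℝ) ≠ 0 := by exact_mod_cast hdim.ne'
    have hnr : (n : ℝ) ≠ 0 := by exact_mod_cast hn0.ne'
    -- The time is chosen so that the scalar `exp c` in `M` has `det ^ n = exp (π i) = -1`, whereas
    -- it must be 1.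
    obtain ⟨m, hm, hme, -⟩ := hL.exists_exp _
      (L.smul_mem (Real.pi / (μ.im * Module.finrank ℂ V * n)) hX)
    have hmdet := hMle _ (isAlgebraicSubgroup_detPowOneSubgroup n).real_of_complex (by
      rintro g ⟨δ, hδ, hgδ⟩
      exact pow_det_eq_one_of_rankOnePerturbation he' (hR δ hδ) hζn hgδ.symm) hm
    rw [mem_detPowOneSubgroup] at hmdet
    set c : ℂ := ((Real.pi / (μ.im * Module.finrank ℂ V * n) : ℝ) : ℂ) * μ with hc
    have hmc : (m : V →ₗ[ℂ] V) = exp c • (1 : V →ₗ[ℂ] V) := by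
      ext x
      refine hme x c ?_
      change ((Real.pi / (μ.im * Module.finrank ℂ V * n) : ℝ) : ℂ) • X x = _
      rw [hXμ, smul_smul]
    have hexp : (n : ℂ) * ((Module.finrank ℂ V : ℂ) * c) = Real.pi * I := by
      rw [hc, hμI]
      have h1 : (μ.im : ℂ) ≠ 0 := ofReal_ne_zero.2 him
      have h2 : (Module.finrank ℂ V : ℂ) ≠ 0 := by exact_mod_cast hd
      have h3 : (n : ℂ) ≠ 0 := by exact_mod_cast hnr
      rw [im_ofReal_mul, I_im, mul_one]
      push_cast
      field_simp
    rw [hmc, LinearMap.det_smul, map_one, mul_one, ← exp_nat_mul, ← exp_nat_mul, hexp,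
      exp_pi_mul_I] at hmdet
    norm_num at hmdet
  have hD : rotationSpace h L δ ≠ ⊥ := by
    intro hbot
    have h1 := hcomp X hX δ hδ
    rw [hbot, Submodule.mem_bot] at h1
    exact hXδ h1
  have hall : ∀ v, h δ v = 0 → formWedge h δ v ∈ L := fun v hv =>
    formWedge_mem_of_mem_rotationSpace (mem_rotationSpace_of_orth hB hn conj_conj hspan hcomp
      hL.bracket_mem hR0 hsplit hδ hD hv)
  exact projectiveImage_eq_top hMG (isometryGroup_le_unitScalarExtension hB hn hL
    (I_smul_formTensor_self_mem hB hn hL.bracket_mem he (hR δ hδ) hall))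

end Unitary

theorem mainTheorem10 {V : Type*} [AddCommGroup V] [Module ℂ V] [FiniteDimensional ℂ V] :
    -- alternating form, transvections
    (∀ (Q : V →ₗ[ℂ] V →ₗ[ℂ] ℂ) (R : Set V) (M : Subgroup (V ≃ₗ[ℂ] V)),
      Q.IsAlt → Q.Nondegenerate → Submodule.span ℂ R = ⊤ →
      M = algebraicHull ℂ (isometryGroup Q)
        ((fun δ => rankOnePerturbation Q 1 δ) '' R) →
      IsFiniteUnionOfOrbits M R →
        SplitsOrthogonally Q M R ∨ M = isometryGroup Q) ∧
    -- symmetric form, reflections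
    (∀ (Q : V →ₗ[ℂ] V →ₗ[ℂ] ℂ) (R : Set V) (M : Subgroup (V ≃ₗ[ℂ] V)),
      (∀ x y, Q x y = Q y x) → Q.Nondegenerate → Submodule.span ℂ R = ⊤ →
      (∀ δ ∈ R, Q δ δ = 2) →
      M = algebraicHull ℂ (isometryGroup Q)
        ((fun δ => rankOnePerturbation Q (-1) δ) '' R) →
      IsFiniteUnionOfOrbits M R →
        SplitsOrthogonally Q M R ∨ Finite M ∨ M = isometryGroup Q) ∧
    -- Hermitian form, complex reflections
    (∀ (ε : ℂ) (h : V →ₗ[ℂ] V →ₗ⋆[ℂ] ℂ) (R : Set V) (ζ : ℂ) (M : Subgroup (V ≃ₗ[ℂ] V)),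
      (ε = 1 ∨ ε = -1) →
      (∀ x y, h x y = starRingEnd ℂ (h y x)) → h.Nondegenerate → Submodule.span ℂ R = ⊤ →
      (∃ n : ℕ, 0 < n ∧ ζ ^ n = 1) → ζ ≠ 1 → ζ ≠ -1 →
      (∀ δ ∈ R, h δ δ = ε) →
      M = algebraicHull ℝ (isometryGroup h)
        ((fun δ => rankOnePerturbation h (ε * (ζ - 1)) δ) '' R) →
      1 < Module.finrank ℂ V →
      IsFiniteUnionOfOrbits M R →
        SplitsOrthogonally h M R ∨ Finite M ∨ projectiveImage h M = ⊤) := by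
  refine ⟨fun Q R M hQ hn hspan hM _ => symplectic_dichotomy hQ hn hspan hM,
    fun Q R M hQ hn hspan hR hM _ => orthogonal_trichotomy hQ hn hspan hR hM,
    fun ε h R ζ M hε hh hn hspan hζ hζ1 hζ2 hR hM hdim _ =>
      unitary_trichotomy hε hh hn hspan hζ hζ1 hζ2 hR hM (zero_lt_one.trans hdim)⟩
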